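/- Work over $\mathbb R$. Let $\mathcal O$ be a cyclic operad, with spaces $\mathcal O[m]$, $m\ge 1$, of operations with $m$ inputs on which $\Sigma_{m+1}$ acts by permuting the input/output slots. For a finite set $A$ with $|A|=m\ge 2$, the space of $\mathcal O$-spiders with set of legs $A$ is the space of coinvariants $\big(\bigoplus_{L}\mathcal O[m-1]\big)_{\Sigma_m}$, where $L$ runs over the bijections $A\to\{0,\dots,m-1\}$ and $\sigma\cdot o_L=(\sigma\cdot o)_{\sigma\circ L}$. If $\lambda$ is a leg of $S$ and $\mu$ a leg of $T$, the mating $(S,\lambda)\circ(\mu,T)$ is obtained by composing operad elements along $\lambda$ (as output) and $\mu$ (as input). An $\mathcal O$-graph $\mathbf X$ is a finite graph $X$ (loops, multiple edges and several components allowed), with set of half-edges $H(X)$ and with $\bar x$ denoting the other half of the edge of the half-edge $x$, such that every vertex has valence at least $2$ and is colored by an $\mathcal O$-spider whose legs are the half-edges at that vertex, together with an orientation: an ordering of the vertices and a direction of each edge, up to an even number of transpositions of vertices and reversals of edges. Let $X_k$ be the real vector space spanned by the isomorphism classes of $\mathcal O$-graphs with $k$ vertices, modulo $(\mathbf X,-or)=-(\mathbf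 X,or)$ and linearity in the color of each vertex, and let $\mathcal{OG}=\bigoplus_k X_k$. For an edge $e$ of $\mathbf X$ let $\mathbf X_e=0$ if $e$ is a loop; otherwise let $\mathbf X_e$ be the $\mathcal O$-graph obtained by collapsing $e$ and mating the spiders at its two ends along the halves of $e$, where, if the orientation is represented so that $e$ goes from the first to the second vertex, the new vertex comes first and all else is unchanged. Put $$\partial_E(\mathbf X)=\sum_{e}\mathbf X_e .$$ For half-edges $x\ne y$ with $x\neq\bar y$ let $\mathbf X^{\pi_{xy}}$ be the $\mathcal O$-graph obtained by cutting the edges $\{x,\bar x\}$ and $\{y,\bar y\}$ and regluing $x$ to $y$ and $\bar x$ to $\bar y$, where, if the orientation is represented so that these edges are directed from $x$ to $\bar x$ and from $\bar y$ to $y$, the new edges are directed from $x$ to $y$ and from $\bar y$ to $\bar x$. The H-boundary is $$\partial_H(\mathbf X)=\sum_{\{x,y\},\;x\ne y,\;x\neq\bar y}(\mathbf X^{\pi_{xy}})_{x\cup y},$$ the sum being over unordered pairs of half-edges and $x\cup y$ being the new edge formed by $x$ and $y$. Then, for the induced linear endomorphisms of $\mathcal{OG}$, (a) $\partial_H^2=0$;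 (b) $\partial_H\partial_E+\partial_E\partial_H=0$. -/

import Mathlib

universe u

/-- A cyclic operad in real vector spaces. `O m` is the space `𝒪[m + 1]` of operations with `m + 1`
inputs, so that its elements have `m + 2` input/output slots, numbered by `Fin (m + 2)`: slot `0` is
the output and slot `i + 1` is the input `i : Fin (m + 1)`. The composition law is given by the
partial compositions `comp h i a b`, which plug the output of `b` into the input `i` of `a`; the
full composition `γ(a ⊗ b₀ ⊗ ⋯ ⊗ bₘ)` is obtained by iterating them, and conversely `comp h i a b`
is `γ(a ⊗ 1 ⊗ ⋯ ⊗ b ⊗ ⋯ ⊗ 1)`. -/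
structure CyclicOperad where
  O : ℕ → Type u
  [instAddCommGroup : ∀ n, AddCommGroup (O n)]
  [instModule : ∀ n, Module ℝ (O n)]
  /-- Renumbering of all the slots: `act n σ o` is `o` with slot `s` renumbered `σ s`. The permutations
  that fix `0` give the operad action of the symmetric group on the inputs. -/
  act : ∀ n, Representation ℝ (Equiv.Perm (Fin (n + 2))) (O n)
  one : O 0
  /-- Plugging `b : O n` into input `i` of `a : O m`. The inputs of the result are the inputs of `a`
  before `i`, then those of `b`, then those of `a` after `i`. The target arity is a variable `k`
  with a proof of `m + n = k`, in order to avoid casts. -/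
  comp : ∀ {m n k : ℕ}, m + n = k → Fin (m + 1) → (O m →ₗ[ℝ] O n →ₗ[ℝ] O k)
  comp_one : ∀ {m : ℕ} (i : Fin (m + 1)) (a : O m), comp (Nat.add_zero m) i a one = a
  one_comp : ∀ {n : ℕ} (b : O n), comp (Nat.zero_add n) 0 one b = b
  /-- Sequential associativity. -/
  comp_seq : ∀ {l m n p q r : ℕ} (h₁ : l + m = p) (h₂ : p + n = r) (h₃ : m + n = q)
    (h₄ : l + q = r) (a : O l) (b : O m) (c : O n)
    (i : Fin (l + 1)) (j : Fin (m + 1)) (t : Fin (p + 1)), (t : ℕ) = i + j →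
    comp h₂ t (comp h₁ i a b) c = comp h₄ i a (comp h₃ j b c)
  /-- Parallel associativity. -/
  comp_par : ∀ {l m n p q r : ℕ} (h₁ : l + m = p) (h₂ : p + n = r) (h₃ : l + n = q)
    (h₄ : q + m = r) (a : O l) (b : O m) (c : O n)
    (i j : Fin (l + 1)) (s : Fin (q + 1)) (t : Fin (p + 1)), i < j →
    (s : ℕ) = i → (t : ℕ) = j + m →
    comp h₂ t (comp h₁ i a b) c = comp h₄ s (comp h₃ j a c) b
  /-- Equivariance: if `σ` and `τ` permute the inputs of `a` and `b` and `σ` carries input `i` to input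
  `j`, then plugging the renumbered `b` into input `j` of the renumbered `a` is the renumbering of
  the composite by the induced permutation `ρ`. In the composite at input `i`, slot `s ≠ i + 1` of
  `a` becomes slot `s` or `s + n` (according to `s ≤ i` or not) and slot `t ≠ 0` of `b` becomes slot
  `i + t`. -/
  comp_equivariant : ∀ {m n k : ℕ} (h : m + n = k) (a : O m) (b : O n) (i j : Fin (m + 1))
    (σ : Equiv.Perm (Fin (m + 2))) (τ : Equiv.Perm (Fin (n + 2))) (ρ : Equiv.Perm (Fin (k + 2))),
    σ 0 = 0 → σ i.succ = j.succ → τ 0 = 0 →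
    (∀ (s : Fin (m + 2)) (u : Fin (k + 2)), s ≠ i.succ →
      (u : ℕ) = (if (s : ℕ) ≤ i then (s : ℕ) else s + n) →
      (ρ u : ℕ) = if (σ s : ℕ) ≤ j then (σ s : ℕ) else σ s + n) →
    (∀ (t : Fin (n + 2)) (u : Fin (k + 2)), t ≠ 0 → (u : ℕ) = i + t → (ρ u : ℕ) = j + τ t) →
    comp h j (act m σ a) (act n τ b) = act k ρ (comp h i a b)
  /-- The unit is invariant under exchanging its two slots. -/
  rotate_one : act 0 (finRotate 2) one = one
  /-- Compatibility of composition with the cyclic rotation `s ↦ s + 1` of the slots (the last input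
  becomes the output). -/
  rotate_comp : ∀ {m n k : ℕ} (h : m + n = k) (h' : n + m = k) (a : O m) (b : O n),
    act k (finRotate (k + 2)) (comp h (Fin.last m) a b) =
      comp h' 0 (act n (finRotate (n + 2)) b) (act m (finRotate (m + 2)) a)

namespace CyclicOperad

attribute [instance] CyclicOperad.instAddCommGroup CyclicOperad.instModule

variable (P : CyclicOperad.{u})

/-- The direct sum of copies of the operad spaces over all labelings `L : A ≃ {0, …, m + 1}` of a set
`A` of legs (only `m = |A| - 2` contributes). -/
abbrev Labelled (A : Type) : Type u :=
  DirectSum (Σ m : ℕ, A ≃ Fin (m + 2)) fun L => P.O L.1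

noncomputable section

open scoped Classical in
/-- The inclusion `o ↦ o_L` of the summand of the labeling `L`. -/
def lab {A : Type} {m : ℕ} (L : A ≃ Fin (m + 2)) : P.O m →ₗ[ℝ] P.Labelled A :=
  DirectSum.lof ℝ (Σ m : ℕ, A ≃ Fin (m + 2)) (fun L => P.O L.1) ⟨m, L⟩

/-- The relations `(σ · o)_{σ · L} = o_L`. -/
def spiderRel (A : Type) : Submodule ℝ (P.Labelled A) :=
  Submodule.span ℝ {z | ∃ (m : ℕ) (L : A ≃ Fin (m + 2)) (σ : Equiv.Perm (Fin (m + 2))) (o : P.O m),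
    z = P.lab (L.trans σ) (P.act m σ o) - P.lab L o}

/-- The space of spiders with set of legs `A`: the coinvariants of the direct sum over labelings under
the symmetric group acting by `σ · o_L = (σ · o)_{σ · L}`. -/
def Spider (A : Type) : Type u := P.Labelled A ⧸ P.spiderRel A

namespace Spider

variable {P}
variable {A B C : Type}

instance : AddCommGroup (P.Spider A) := inferInstanceAs (AddCommGroup (P.Labelled A ⧸ P.spiderRel A))
instance : Module ℝ (P.Spider A) := inferInstanceAs (Module ℝ (P.Labelled A ⧸ P.spiderRel A))

/-- The spider `[o_L]`. -/
def mk {m : ℕ} (L : A ≃ Fin (m + 2)) : P.O m →ₗ[ℝ] P.Spider A :=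
  (P.spiderRel A).mkQ ∘ₗ P.lab L

theorem mk_act {m : ℕ} (L : A ≃ Fin (m + 2)) (σ : Equiv.Perm (Fin (m + 2))) (o : P.O m) :
    mk (L.trans σ) (P.act m σ o) = mk L o := by
  refine (Submodule.Quotient.eq (P.spiderRel A)).2 (Submodule.subset_span ⟨m, L, σ, o, rfl⟩)

open scoped Classical in
def lift {M : Type*} [AddCommGroup M] [Module ℝ M]
    (f : ∀ m : ℕ, (A ≃ Fin (m + 2)) → (P.O m →ₗ[ℝ] M))
    (hf : ∀ (m : ℕ) (L : A ≃ Fin (m + 2)) (σ : Equiv.Perm (Fin (m + 2))) (o : P.O m),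
      f m (L.trans σ) (P.act m σ o) = f m L o) : P.Spider A →ₗ[ℝ] M :=
  (P.spiderRel A).liftQ (DirectSum.toModule ℝ _ M fun L => f L.1 L.2) (by
    refine Submodule.span_le.2 ?_
    rintro _ ⟨m, L, σ, o, rfl⟩
    simp [lab, DirectSum.toModule_lof, hf])

@[simp] theorem lift_mk {M : Type*} [AddCommGroup M] [Module ℝ M]
    (f : ∀ m : ℕ, (A ≃ Fin (m + 2)) → (P.O m →ₗ[ℝ] M)) (hf) {m : ℕ} (L : A ≃ Fin (m + 2))
    (o : P.O m) : lift f hf (mk L o) = f m L o := by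
  classical
  simp only [lift, mk]
  erw [Submodule.liftQ_apply]
  simp only [lab]
  convert DirectSum.toModule_lof (M := fun L : (Σ m : ℕ, A ≃ Fin (m + 2)) => P.O L.1) ℝ
    (φ := fun L => f L.1 L.2) (⟨m, L⟩ : (Σ m : ℕ, A ≃ Fin (m + 2))) o

theorem hom_ext {M : Type*} [AddCommGroup M] [Module ℝ M] {f g : P.Spider A →ₗ[ℝ] M}
    (h : ∀ (m : ℕ) (L : A ≃ Fin (m + 2)) (o : P.O m), f (mk L o) = g (mk L o)) : f = g := by
  classical
  refine Submodule.linearMap_qext _ (DirectSum.linearMap_ext _ fun L => LinearMap.ext fun o => ?_)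
  exact h L.1 L.2 o

/-- Transport of a spider along a bijection of its set of legs. -/
def map (e : A ≃ B) : P.Spider A →ₗ[ℝ] P.Spider B :=
  lift (fun _ L => mk (e.symm.trans L)) fun _ L σ o => mk_act (e.symm.trans L) σ o

@[simp] theorem map_mk (e : A ≃ B) {m : ℕ} (L : A ≃ Fin (m + 2)) (o : P.O m) :
    map e (mk L o) = mk (e.symm.trans L) o :=
  lift_mk _ _ L o

theorem map_map (e : A ≃ B) (f : B ≃ C) (S : P.Spider A) :
    map f (map e S) = map (e.trans f) S := by
  have : (map f ∘ₗ map e : P.Spider A →ₗ[ℝ] P.Spider C) = map (e.trans f) :=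
    hom_ext fun m L o => by simp [Equiv.trans_assoc, Equiv.symm_trans]
  exact LinearMap.congr_fun this S

/-- The labeling of the legs of a mated spider, for labelings `L`, `K` with `L lam = 0` and `K mu = 1`:
the remaining legs on the `lam` side are inserted, in order, at the slot formerly occupied by
`mu`. -/
def mateLabel {m n k : ℕ} (h : n + m = k) (L : A ≃ Fin (m + 2)) (K : B ≃ Fin (n + 2)) (lam : A) (mu : B)
    (hL : L lam = 0) (hK : K mu = 1) : ({a // a ≠ lam} ⊕ {b // b ≠ mu}) ≃ Fin (k + 2) where
  toFun := Sum.elim (fun a => ⟨L a, by omega⟩)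
    (fun b => ⟨if K b = 0 then 0 else K b + m, by split_ifs <;> omega⟩)
  invFun u := if h0 : u.val = 0 then Sum.inr ⟨K.symm 0, fun e => by simp [← e] at hK⟩
    else if h1 : u.val ≤ m + 1 then
      Sum.inl ⟨L.symm ⟨u, by omega⟩, fun e => by
        rw [Equiv.symm_apply_eq, hL, Fin.ext_iff] at e; exact h0 e⟩
    else Sum.inr ⟨K.symm ⟨u - m, by omega⟩, fun e => by
        rw [Equiv.symm_apply_eq, hK, Fin.ext_iff] at e; simp at e; omega⟩
  left_inv := by
    rintro (⟨a, ha⟩ | ⟨b, hb⟩)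
    · have : L a ≠ 0 := fun e => ha (L.injective (e.trans hL.symm))
      have h2 : (L a : ℕ) ≠ 0 := fun e => this (Fin.ext e)
      have h3 : (L a : ℕ) ≤ m + 1 := by omega
      simp [h2, h3]
    · have h1 : K b ≠ 1 := fun e => hb (K.injective (e.trans hK.symm))
      have h2 : (K b : ℕ) ≠ 1 := fun e => h1 (Fin.ext (by simpa using e))
      by_cases h0 : K b = 0
      · have h5 : K.symm 0 = b := (Equiv.symm_apply_eq K).2 h0.symm
        simp [h0, h5]
      · have h3 : (K b : ℕ) ≠ 0 := fun e => h0 (Fin.ext e)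
        have h4 : ¬ ((K b : ℕ) + m ≤ m + 1) := by omega
        simp [h0, h3, h4]
  right_inv := by
    intro u
    apply Fin.ext
    by_cases h0 : u.val = 0
    · simp [h0]
    · by_cases h1 : u.val ≤ m + 1
      · simp [h0, h1]
      · have : ¬ ((⟨u - m, by omega⟩ : Fin (n + 2)) = 0) := by
          rw [Fin.ext_iff]; simp; omega
        simp only [h0, h1, dite_false, Sum.elim_inr, Equiv.apply_symm_apply, this, if_false]
        omega

theorem mateLabel_inl {m n k : ℕ} (h : n + m = k) (L : A ≃ Fin (m + 2)) (K : B ≃ Fin (n + 2))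
    (lam : A) (mu : B) (hL : L lam = 0) (hK : K mu = 1) (a : {a // a ≠ lam}) :
    (mateLabel h L K lam mu hL hK (Sum.inl a) : ℕ) = L a := rfl

theorem mateLabel_inr {m n k : ℕ} (h : n + m = k) (L : A ≃ Fin (m + 2)) (K : B ≃ Fin (n + 2))
    (lam : A) (mu : B) (hL : L lam = 0) (hK : K mu = 1) (b : {b // b ≠ mu}) :
    (mateLabel h L K lam mu hL hK (Sum.inr b) : ℕ) = if K b = 0 then 0 else K b + m := rfl

theorem mate_aux_inner {m n k : ℕ} (h : n + m = k) (L : A ≃ Fin (m + 2)) (K : B ≃ Fin (n + 2))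
    (lam : A) (mu : B) (hL : L lam = 0) (hK : K mu = 1) (σ : Equiv.Perm (Fin (m + 2)))
    (hL' : (L.trans σ) lam = 0) (a : P.O m) (b : P.O n) :
    mk (mateLabel h (L.trans σ) K lam mu hL' hK) (P.comp h 0 b (P.act m σ a)) =
      mk (mateLabel h L K lam mu hL hK) (P.comp h 0 b a) := by
  have hσ : σ 0 = 0 := by simpa [hL] using hL'
  set e := mateLabel h L K lam mu hL hK with he
  set e' := mateLabel h (L.trans σ) K lam mu hL' hK with he'
  have key : P.comp h 0 b (P.act m σ a) = P.act k (e.symm.trans e') (P.comp h 0 b a) := by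
    have := P.comp_equivariant h b a 0 0 1 σ (e.symm.trans e') rfl rfl hσ ?_ ?_
    · simpa using this
    · intro s u hs hu
      have hmu : K.symm s ≠ mu := fun e0 => hs (by rw [← Equiv.apply_symm_apply K s, e0, hK]; rfl)
      have hs1 : (s : ℕ) ≠ 1 := fun e0 => hs (Fin.ext (by simpa using e0))
      have h1 : u = e (Sum.inr ⟨K.symm s, hmu⟩) := by
        apply Fin.ext
        rw [he, mateLabel_inr, hu]
        simp only [Equiv.apply_symm_apply, Fin.ext_iff, Fin.val_zero, Nat.le_zero]
        split_ifs <;> omega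
      rw [h1, Equiv.trans_apply, Equiv.symm_apply_apply, he', mateLabel_inr]
      simp only [Equiv.apply_symm_apply, Fin.ext_iff, Fin.val_zero, Nat.le_zero,
        Equiv.Perm.one_apply]
      split_ifs <;> omega
    · intro t u ht hu
      have hlam : L.symm t ≠ lam := fun e0 => ht (by rw [← Equiv.apply_symm_apply L t, e0, hL])
      have h1 : u = e (Sum.inl ⟨L.symm t, hlam⟩) := by
        apply Fin.ext
        rw [he, mateLabel_inl, hu]
        simp
      rw [h1, Equiv.trans_apply, Equiv.symm_apply_apply, he', mateLabel_inl]
      simp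
  rw [key, ← mk_act e (e.symm.trans e')]
  congr 2
  ext x
  simp

theorem rotate_val {n : ℕ} (i : Fin (n + 2)) :
    (finRotate (n + 2) i : ℕ) = if (i : ℕ) = n + 1 then 0 else (i : ℕ) + 1 := by
  rw [coe_finRotate]
  simp [Fin.ext_iff]

theorem mate_aux_outer {m n k : ℕ} (h : n + m = k) (L : A ≃ Fin (m + 2)) (K : B ≃ Fin (n + 2))
    (lam : A) (mu : B) (hL : L lam = 0) (hK : K mu = 1) (τ : Equiv.Perm (Fin (n + 2)))
    (hK' : (K.trans τ) mu = 1) (a : P.O m) (b : P.O n) :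
    mk (mateLabel h L (K.trans τ) lam mu hL hK') (P.comp h 0 (P.act n τ b) a) =
      mk (mateLabel h L K lam mu hL hK) (P.comp h 0 b a) := by
  have hτ : τ 1 = 1 := by simpa [hK] using hK'
  set e := mateLabel h L K lam mu hL hK with he
  set e' := mateLabel h L (K.trans τ) lam mu hL hK' with he'
  have inlE : ∀ u : Fin (k + 2), 1 ≤ (u : ℕ) → (u : ℕ) ≤ m + 1 → e' (e.symm u) = u := by
    intro u h1 h2
    have hlam : L.symm ⟨u, by omega⟩ ≠ lam := fun e0 => by
      rw [Equiv.symm_apply_eq, hL, Fin.ext_iff] at e0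
      simp only [Fin.val_zero] at e0
      omega
    have hu : u = e (Sum.inl ⟨L.symm ⟨u, by omega⟩, hlam⟩) := by
      apply Fin.ext
      rw [he, mateLabel_inl]
      simp
    conv_lhs => rw [hu]
    rw [Equiv.symm_apply_apply]
    apply Fin.ext
    rw [he', mateLabel_inl]
    simp
  have inrE : ∀ (t : Fin (n + 2)) (u : Fin (k + 2)), (t : ℕ) ≠ 1 →
      (u : ℕ) = (if (t : ℕ) = 0 then 0 else (t : ℕ) + m) →
      (e' (e.symm u) : ℕ) = if (τ t : ℕ) = 0 then 0 else (τ t : ℕ) + m := by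
    intro t u ht hu
    have hmu : K.symm t ≠ mu := fun e0 => ht (by
      rw [Equiv.symm_apply_eq, hK] at e0
      rw [e0]; simp)
    have h1 : u = e (Sum.inr ⟨K.symm t, hmu⟩) := by
      apply Fin.ext
      rw [he, mateLabel_inr, hu]
      simp only [Equiv.apply_symm_apply, Fin.ext_iff]
      simp
    rw [h1, Equiv.symm_apply_apply, he', mateLabel_inr]
    simp only [Equiv.trans_apply, Equiv.apply_symm_apply, Fin.ext_iff]
    simp
  have key : P.comp h 0 (P.act n τ b) a = P.act k (e.symm.trans e') (P.comp h 0 b a) := by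
    have h' : m + n = k := by omega
    obtain ⟨a₀, rfl⟩ : ∃ a₀, P.act m (finRotate (m + 2)) a₀ = a :=
      ⟨P.act m (finRotate (m + 2))⁻¹ a, by simp [← Module.End.mul_apply, ← map_mul]⟩
    obtain ⟨b₀, rfl⟩ : ∃ b₀, P.act n (finRotate (n + 2)) b₀ = b :=
      ⟨P.act n (finRotate (n + 2))⁻¹ b, by simp [← Module.End.mul_apply, ← map_mul]⟩
    set r := finRotate (n + 2) with hr
    set R := finRotate (k + 2) with hR
    have e1 : P.act n τ (P.act n r b₀) = P.act n r (P.act n (r⁻¹ * τ * r) b₀) := by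
      simp only [← Module.End.mul_apply, ← map_mul]
      congr 2
      group
    rw [e1, ← P.rotate_comp h' h, ← P.rotate_comp h' h]
    have e2 : P.comp h' (Fin.last m) a₀ (P.act n (r⁻¹ * τ * r) b₀) =
        P.act k (R⁻¹ * (e.symm.trans e' : Equiv.Perm _) * R) (P.comp h' (Fin.last m) a₀ b₀) := by
      have := P.comp_equivariant h' a₀ b₀ (Fin.last m) (Fin.last m) 1 (r⁻¹ * τ * r)
        (R⁻¹ * (e.symm.trans e' : Equiv.Perm _) * R) rfl rfl ?_ ?_ ?_
      · simpa using this
      · have : r 0 = 1 := by apply Fin.ext; rw [hr, rotate_val]; simp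
        simp [this, hτ, Equiv.Perm.inv_def, Equiv.symm_apply_eq]
      · intro s u hs hu
        have hs' : (s : ℕ) ≤ m := by
          have : (s : ℕ) ≠ m + 1 := fun e0 => hs (Fin.ext (by simpa using e0))
          omega
        simp [hs'] at hu
        have hRu : (R u : ℕ) = s + 1 := by
          rw [hR, rotate_val, if_neg (by omega), hu]
        have : (R⁻¹ * (e.symm.trans e' : Equiv.Perm _) * R) u = u := by
          simp only [Equiv.Perm.mul_apply, Equiv.Perm.inv_def, Equiv.symm_apply_eq, Equiv.trans_apply]
          exact inlE _ (by omega) (by omega)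
        rw [this, hu]
        simp [hs']
      · intro t u ht hu
        have ht' : (t : ℕ) ≠ 0 := fun e0 => ht (Fin.ext e0)
        have hv : ∃ v : Fin (k + 2), (v : ℕ) = m + (r⁻¹ * τ * r) t := ⟨⟨m + (r⁻¹ * τ * r) t, by omega⟩, rfl⟩
        obtain ⟨v, hv⟩ := hv
        have hvt : r ((r⁻¹ * τ * r) t) = τ (r t) := by simp
        have hne : (r⁻¹ * τ * r) t ≠ 0 := by
          intro e0
          rw [e0] at hvt
          have h10 : r 0 = 1 := by apply Fin.ext; rw [hr, rotate_val]; simp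
          rw [h10, ← hτ] at hvt
          exact ht (r.injective ((τ.injective hvt).symm.trans h10.symm))
        have hne' : ((r⁻¹ * τ * r) t : ℕ) ≠ 0 := fun e0 => hne (Fin.ext e0)
        have hrt : (r t : ℕ) ≠ 1 := by
          rw [hr, rotate_val]; split_ifs <;> omega
        have h2 := inrE (r t) (R u) hrt (by
          rw [hr, hR, rotate_val, rotate_val, hu]
          simp only [Fin.val_last]
          split_ifs <;> omega)
        have : (R⁻¹ * (e.symm.trans e' : Equiv.Perm _) * R) u = v := by
          simp only [Equiv.Perm.mul_apply, Equiv.Perm.inv_def, Equiv.symm_apply_eq, Equiv.trans_apply]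
          apply Fin.ext
          have h3 := congrArg Fin.val hvt
          rw [h2, ← h3, hr, hR, rotate_val, rotate_val, hv]
          simp only [← hr]
          split_ifs <;> omega
        rw [this, hv]
        simp
    rw [e2]
    simp only [← Module.End.mul_apply, ← map_mul]
    congr 2
    rw [← hR]
    group
  rw [key, ← mk_act e (e.symm.trans e')]
  congr 2
  ext x
  simp

/-- Mating of labelled operad elements: relabel so that `lam` gets label `0` (the output) and `mu` gets
label `1` (the first input), then compose. -/
def mateAux (lam : A) (mu : B) {m n : ℕ} (L : A ≃ Fin (m + 2)) (K : B ≃ Fin (n + 2)) :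
    P.O n →ₗ[ℝ] P.O m →ₗ[ℝ] P.Spider ({a // a ≠ lam} ⊕ {b // b ≠ mu}) :=
  ((P.comp rfl 0).compl₁₂ (P.act n (Equiv.swap (K mu) 1)) (P.act m (Equiv.swap (L lam) 0))).compr₂
    (mk (mateLabel rfl (L.trans (Equiv.swap (L lam) 0)) (K.trans (Equiv.swap (K mu) 1)) lam mu
      (by simp) (by simp)))

theorem mateAux_apply (lam : A) (mu : B) {m n : ℕ} (L : A ≃ Fin (m + 2)) (K : B ≃ Fin (n + 2))
    (a : P.O m) (b : P.O n) (σ : Equiv.Perm (Fin (m + 2))) (τ : Equiv.Perm (Fin (n + 2)))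
    (hσ : (L.trans σ) lam = 0) (hτ : (K.trans τ) mu = 1) :
    mateAux lam mu L K b a =
      mk (mateLabel rfl (L.trans σ) (K.trans τ) lam mu hσ hτ)
        (P.comp rfl 0 (P.act n τ b) (P.act m σ a)) := by
  set σ₀ := Equiv.swap (L lam) 0 with hσ₀
  set τ₀ := Equiv.swap (K mu) 1 with hτ₀
  have h1 : (L.trans σ₀) lam = 0 := by simp [hσ₀]
  have h2 : (K.trans τ₀) mu = 1 := by simp [hτ₀]
  have e1 : L.trans σ = (L.trans σ₀).trans (σ * σ₀⁻¹) := by ext; simp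
  have e2 : K.trans τ = (K.trans τ₀).trans (τ * τ₀⁻¹) := by ext; simp
  have e3 : P.act m σ a = P.act m (σ * σ₀⁻¹) (P.act m σ₀ a) := by
    simp only [← Module.End.mul_apply, ← map_mul]; congr 2; group
  have e4 : P.act n τ b = P.act n (τ * τ₀⁻¹) (P.act n τ₀ b) := by
    simp only [← Module.End.mul_apply, ← map_mul]; congr 2; group
  simp only [e1, e2] at hσ hτ ⊢
  rw [e3, e4, mate_aux_inner rfl (L.trans σ₀) _ lam mu h1 hτ, mate_aux_outer rfl _ _ lam mu h1 h2]
  rfl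

/-- The mating law `(S, lam) ∘ (mu, T)`; by `mate_mk` it sends `[a_L]`, `[b_K]` with `L lam = 0` and
`K mu = 1` to the class of `γ(b ⊗ a ⊗ 1 ⊗ ⋯ ⊗ 1)` with the induced labeling. -/
def mate (lam : A) (mu : B) :
    P.Spider A →ₗ[ℝ] P.Spider B →ₗ[ℝ] P.Spider ({a // a ≠ lam} ⊕ {b // b ≠ mu}) :=
  lift (fun _ L => (lift (fun _ K => mateAux lam mu L K) (by
      intro n K τ b
      ext a
      rw [mateAux_apply lam mu L K a b (Equiv.swap (L lam) 0)
        (Equiv.swap ((K.trans τ) mu) 1 * τ) (by simp) (by simp)]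
      simp only [map_mul, Module.End.mul_apply]
      rfl)).flip) (by
    intro m L σ a
    refine hom_ext fun n K b => ?_
    simp only [LinearMap.flip_apply, lift_mk]
    rw [mateAux_apply lam mu L K a b (Equiv.swap ((L.trans σ) lam) 0 * σ)
        (Equiv.swap (K mu) 1) (by simp) (by simp)]
    simp only [map_mul, Module.End.mul_apply]
    rfl)

theorem mate_mk (lam : A) (mu : B) {m n : ℕ} (L : A ≃ Fin (m + 2)) (K : B ≃ Fin (n + 2))
    (a : P.O m) (b : P.O n) (hL : L lam = 0) (hK : K mu = 1) :
    mate lam mu (mk L a) (mk K b) = mk (mateLabel rfl L K lam mu hL hK) (P.comp rfl 0 b a) := by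
  simp only [mate, lift_mk, LinearMap.flip_apply]
  rw [mateAux_apply lam mu L K a b 1 1 hL hK]
  simp
  rfl

theorem mate_map {A' B' : Type} (e : A ≃ A') (f : B ≃ B') (lam : A) (mu : B) (lam' : A')
    (mu' : B') (he : e lam = lam') (hf : f mu = mu') (S : P.Spider A) (T : P.Spider B) :
    mate lam' mu' (map e S) (map f T) =
      map (Equiv.sumCongr (e.subtypeEquiv fun a => by rw [← he, Ne, Ne, e.injective.eq_iff])
        (f.subtypeEquiv fun b => by rw [← hf, Ne, Ne, f.injective.eq_iff])) (mate lam mu S T) := by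
  subst he hf
  set E := Equiv.sumCongr (e.subtypeEquiv (p := (· ≠ lam)) (q := (· ≠ e lam)) fun a => by
      rw [Ne, Ne, e.injective.eq_iff])
    (f.subtypeEquiv (p := (· ≠ mu)) (q := (· ≠ f mu)) fun b => by rw [Ne, Ne, f.injective.eq_iff])
  have : ((mate (e lam) (f mu)).compl₁₂ (map e) (map f) :
      P.Spider A →ₗ[ℝ] P.Spider B →ₗ[ℝ] P.Spider _) = (mate lam mu).compr₂ (map E) := by
    refine hom_ext fun m L a => hom_ext fun n K b => ?_
    simp only [LinearMap.compl₁₂_apply, LinearMap.compr₂_apply, map_mk]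
    simp only [mate, lift_mk, LinearMap.flip_apply]
    rw [mateAux_apply lam mu L K a b (Equiv.swap (L lam) 0) (Equiv.swap (K mu) 1) (by simp)
      (by simp), map_mk, mateAux_apply (e lam) (f mu) (e.symm.trans L) (f.symm.trans K) a b
      (Equiv.swap (L lam) 0) (Equiv.swap (K mu) 1) (by simp) (by simp)]
    congr 2
    ext (x | x) <;> rfl
  exact LinearMap.congr_fun (LinearMap.congr_fun this S) T

end Spider
end
end CyclicOperad

noncomputable section

variable {P : CyclicOperad.{u}} {k : ℕ}

/-- An `𝒪`-graph with `k` vertices, with a chosen representative of its orientation: the vertices are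
numbered by `Fin k`, which is their ordering, `H` is the set of half-edges, `vert` the vertex at
which a half-edge is attached, `bar` exchanges the two halves of every edge, and `dir h` is `1` if
`h` is the initial half of its edge and `-1` if it is the terminal half. Each vertex is colored by
a spider whose legs are the half-edges at that vertex, and has at least two of them. Loops,
multiple edges and disconnected graphs are allowed. -/
structure OGraph (P : CyclicOperad.{u}) (k : ℕ) where
  H : Type
  [instFintype : Fintype H]
  [instDecidableEq : DecidableEq H]
  vert : H → Fin k
  bar : H → H
  bar_bar : ∀ h, bar (bar h) = h
  bar_ne : ∀ h, bar h ≠ h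
  dir : H → ℤˣ
  dir_bar : ∀ h, dir (bar h) = -dir h
  color : ∀ v : Fin k, P.Spider {h : H // vert h = v}
  two_le_valence : ∀ v : Fin k, 2 ≤ Nat.card {h : H // vert h = v}

namespace OGraph

attribute [instance] OGraph.instFintype OGraph.instDecidableEq

/-- The bijection between the half-edges at corresponding vertices. -/
def fiberEquiv {H H' : Type} {vert : H → Fin k} {vert' : H' → Fin k} (σ : Equiv.Perm (Fin k))
    (g : H ≃ H') (hg : ∀ h, vert' (g h) = σ (vert h)) {v v' : Fin k} (hv : σ v = v') :
    {h : H // vert h = v} ≃ {h : H' // vert' h = v'} :=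
  g.subtypeEquiv fun h => by rw [hg, ← hv, σ.injective.eq_iff]

/-- An isomorphism of the underlying `𝒪`-graphs; it need not respect the vertex orderings and the
directions of the edges. -/
structure Iso (G G' : OGraph P k) where
  onVert : Equiv.Perm (Fin k)
  onHalf : G.H ≃ G'.H
  vert_eq : ∀ h, G'.vert (onHalf h) = onVert (G.vert h)
  bar_eq : ∀ h, G'.bar (onHalf h) = onHalf (G.bar h)
  color_eq : ∀ v, G'.color (onVert v) =
    CyclicOperad.Spider.map (fiberEquiv onVert onHalf vert_eq rfl) (G.color v)

/-- The sign comparing the two orientations along an isomorphism: the sign of the permutation of the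
vertices times `-1` for every edge whose direction is reversed. -/
def Iso.sign {G G' : OGraph P k} (f : Iso G G') : ℤˣ :=
  Equiv.Perm.sign f.onVert * ∏ h : G.H, if G.dir h = 1 then G'.dir (f.onHalf h) else 1

/-- The `𝒪`-graph with the color of the vertex `v` replaced by `S`. -/
def setColor (G : OGraph P k) (v : Fin k) (S : P.Spider {h : G.H // G.vert h = v}) :
    OGraph P k :=
  { G with color := Function.update G.color v S }

variable (P k) in
/-- The relations between `𝒪`-graphs: isomorphic ones are identified, up to the sign that compares
their orientations (in particular reversing the orientation changes the sign), and an `𝒪`-graph is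
linear in the color of each vertex. -/
def relations : Submodule ℝ (OGraph P k →₀ ℝ) :=
  Submodule.span ℝ
    ({z | ∃ (G G' : OGraph P k) (f : Iso G G'),
        z = Finsupp.single G 1 - ((f.sign : ℤ) : ℝ) • Finsupp.single G' 1} ∪
     {z | ∃ (G : OGraph P k) (v : Fin k) (a b : ℝ) (S T : P.Spider {h : G.H // G.vert h = v}),
        z = Finsupp.single (G.setColor v (a • S + b • T)) 1 -
          (a • Finsupp.single (G.setColor v S) 1 + b • Finsupp.single (G.setColor v T) 1)})

end OGraph

/-- The group of `k`-chains. -/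
abbrev ChainGroup (P : CyclicOperad.{u}) (k : ℕ) : Type (max u 1) :=
  (OGraph P k →₀ ℝ) ⧸ OGraph.relations P k

namespace OGraph

/-- The class of an `𝒪`-graph. -/
def toChain (G : OGraph P k) : ChainGroup P k :=
  (relations P k).mkQ (Finsupp.single G 1)

theorem toChain_iso {G G' : OGraph P k} (f : Iso G G') :
    G.toChain = ((f.sign : ℤ) : ℝ) • G'.toChain := by
  rw [toChain, toChain, ← map_smul]
  exact (Submodule.Quotient.eq _).2 (Submodule.subset_span (Or.inl ⟨G, G', f, rfl⟩))

theorem toChain_linear (G : OGraph P k) (v : Fin k) (a b : ℝ)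
    (S T : P.Spider {h : G.H // G.vert h = v}) :
    (G.setColor v (a • S + b • T)).toChain =
      a • (G.setColor v S).toChain + b • (G.setColor v T).toChain := by
  simp only [toChain, ← map_smul, ← map_add]
  exact (Submodule.Quotient.eq _).2 (Submodule.subset_span (Or.inr ⟨G, v, a, b, S, T, rfl⟩))

theorem relations_le {M : Type*} [AddCommGroup M] [Module ℝ M] (F : OGraph P k → M)
    (h₁ : ∀ (G G' : OGraph P k) (f : Iso G G'), F G = ((f.sign : ℤ) : ℝ) • F G')
    (h₂ : ∀ (G : OGraph P k) (v : Fin k) (a b : ℝ) (S T : P.Spider {h : G.H // G.vert h = v}),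
      F (G.setColor v (a • S + b • T)) = a • F (G.setColor v S) + b • F (G.setColor v T)) :
    relations P k ≤ LinearMap.ker (Finsupp.lift M ℝ (OGraph P k) F) := by
  refine Submodule.span_le.2 ?_
  rintro _ (⟨G, G', f, rfl⟩ | ⟨G, v, a, b, S, T, rfl⟩)
  · have := h₁ G G' f
    simp only [SetLike.mem_coe, LinearMap.mem_ker, map_sub, map_smul, Finsupp.lift_apply,
      Finsupp.sum_single_index, zero_smul, one_smul]
    rw [this, sub_self]
  · have := h₂ G v a b S T
    simp only [SetLike.mem_coe, LinearMap.mem_ker, map_sub, map_add, map_smul,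
      Finsupp.lift_apply, Finsupp.sum_single_index, zero_smul, one_smul]
    rw [this, sub_self]

/-- The linear map defined by a function on `𝒪`-graphs that respects the relations. -/
def liftChain {M : Type*} [AddCommGroup M] [Module ℝ M] (F : OGraph P k → M)
    (h₁ : ∀ (G G' : OGraph P k) (f : Iso G G'), F G = ((f.sign : ℤ) : ℝ) • F G')
    (h₂ : ∀ (G : OGraph P k) (v : Fin k) (a b : ℝ) (S T : P.Spider {h : G.H // G.vert h = v}),
      F (G.setColor v (a • S + b • T)) = a • F (G.setColor v S) + b • F (G.setColor v T)) :
    ChainGroup P k →ₗ[ℝ] M :=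
  (relations P k).liftQ (Finsupp.lift M ℝ (OGraph P k) F) (relations_le F h₁ h₂)

theorem liftChain_toChain {M : Type*} [AddCommGroup M] [Module ℝ M] (F : OGraph P k → M) (h₁ h₂)
    (G : OGraph P k) : liftChain F h₁ h₂ G.toChain = F G := by
  rw [liftChain, toChain, Submodule.mkQ_apply, Submodule.liftQ_apply, Finsupp.lift_apply]
  exact (Finsupp.sum_single_index (zero_smul ℝ (F G))).trans (one_smul ℝ (F G))

/-- Merging of the vertex `w` into the vertex `v`: the remaining vertices are renumbered in order, and
the merged vertex takes the place of `v`. -/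
def mergeVert (v w : Fin (k + 1)) (h : v ≠ w) (u : Fin (k + 1)) : Fin k :=
  (finSuccAboveEquiv w).symm (if hu : u = w then ⟨v, h⟩ else ⟨u, hu⟩)

theorem succAbove_mergeVert (v w : Fin (k + 1)) (h : v ≠ w) (u : Fin (k + 1)) :
    w.succAbove (mergeVert v w h u) = if u = w then v else u := by
  have := congrArg Subtype.val
    ((finSuccAboveEquiv w).apply_symm_apply (if hu : u = w then ⟨v, h⟩ else ⟨u, hu⟩))
  rw [finSuccAboveEquiv_apply] at this
  rw [mergeVert]
  refine this.trans ?_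
  split_ifs <;> rfl

theorem mergeVert_eq_iff (v w : Fin (k + 1)) (h : v ≠ w) (u : Fin (k + 1)) (t : Fin k) :
    mergeVert v w h u = t ↔ (if u = w then v else u) = w.succAbove t := by
  rw [← succAbove_mergeVert v w h, Fin.succAbove_right_inj]

variable (G : OGraph P (k + 1)) (x : G.H) (hx : G.vert x ≠ G.vert (G.bar x))

/-- The half-edges at a vertex that is not involved in the collapse. -/
def otherLegs (t : Fin k) (ht : (G.vert (G.bar x)).succAbove t ≠ G.vert x) :
    {h : G.H // G.vert h = (G.vert (G.bar x)).succAbove t} ≃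
      {h : {h : G.H // h ≠ x ∧ h ≠ G.bar x} // mergeVert _ _ hx (G.vert h) = t} where
  toFun h := ⟨⟨h.1, fun e => ht (by rw [← h.2, e]), fun e => Fin.succAbove_ne _ t (by
    rw [← h.2, e])⟩, by
      rw [mergeVert_eq_iff, if_neg (by rw [h.2]; exact Fin.succAbove_ne _ _), h.2]⟩
  invFun h := ⟨h.1.1, by
    have := (mergeVert_eq_iff _ _ hx _ _).1 h.2
    split_ifs at this with h1
    · exact absurd this.symm ht
    · exact this⟩
  left_inv _ := rfl
  right_inv _ := rfl

/-- The half-edges at the merged vertex. -/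
def mergedLegs (t : Fin k) (ht : (G.vert (G.bar x)).succAbove t = G.vert x) :
    ({a : {h : G.H // G.vert h = G.vert x} // a ≠ ⟨x, rfl⟩} ⊕
        {b : {h : G.H // G.vert h = G.vert (G.bar x)} // b ≠ ⟨G.bar x, rfl⟩}) ≃
      {h : {h : G.H // h ≠ x ∧ h ≠ G.bar x} // mergeVert _ _ hx (G.vert h) = t} where
  toFun := Sum.elim
    (fun a => ⟨⟨a.1.1, fun e => a.2 (Subtype.ext e), fun e => hx (by rw [← a.1.2, e])⟩, by
      rw [mergeVert_eq_iff, ht, a.1.2, if_neg hx]⟩)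
    (fun b => ⟨⟨b.1.1, fun e => hx (by rw [← b.1.2, e]), fun e => b.2 (Subtype.ext e)⟩, by
      rw [mergeVert_eq_iff, ht, b.1.2, if_pos rfl]⟩)
  invFun h := if hw : G.vert h.1.1 = G.vert (G.bar x) then
      Sum.inr ⟨⟨h.1.1, hw⟩, fun e => h.1.2.2 (congrArg Subtype.val e)⟩
    else Sum.inl ⟨⟨h.1.1, by
      have := (mergeVert_eq_iff _ _ hx _ _).1 h.2
      rwa [if_neg hw, ht] at this⟩, fun e => h.1.2.1 (congrArg Subtype.val e)⟩
  left_inv := by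
    rintro (a | b)
    · have : G.vert a.1.1 ≠ G.vert (G.bar x) := by rw [a.1.2]; exact hx
      simp [this]
    · simp [b.1.2]
  right_inv h := by
    by_cases hw : G.vert h.1.1 = G.vert (G.bar x)
    · simp only [hw, dite_true, Sum.elim_inr]
    · simp only [hw, dite_false, Sum.elim_inl]

/-- The colors after the collapse: the two spiders at the ends of the edge are mated. -/
def collapseColor (t : Fin k) :
    P.Spider {h : {h : G.H // h ≠ x ∧ h ≠ G.bar x} // mergeVert _ _ hx (G.vert h) = t} :=
  if ht : (G.vert (G.bar x)).succAbove t = G.vert x then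
    CyclicOperad.Spider.map (G.mergedLegs x hx t ht)
      (CyclicOperad.Spider.mate ⟨x, rfl⟩ ⟨G.bar x, rfl⟩
        (G.color (G.vert x)) (G.color (G.vert (G.bar x))))
  else CyclicOperad.Spider.map (G.otherLegs x hx t ht) (G.color ((G.vert (G.bar x)).succAbove t))

/-- Collapse of the edge `{x, bar x}`, which is not a loop, with `v = vert x` and `w = vert (bar x)`: the
edge is removed, and `w` is merged into `v`, at the place of `v` in the ordering of the vertices. -/
def collapse : OGraph P k where
  H := {h : G.H // h ≠ x ∧ h ≠ G.bar x}
  vert h := mergeVert _ _ hx (G.vert h)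
  bar h := ⟨G.bar h, fun e => h.2.2 ((G.bar_bar h.1).symm.trans (congrArg G.bar e)), fun e => h.2.1
    ((G.bar_bar h.1).symm.trans ((congrArg G.bar e).trans (G.bar_bar x)))⟩
  bar_bar h := Subtype.ext (G.bar_bar h)
  bar_ne h e := G.bar_ne h (congrArg Subtype.val e)
  dir h := G.dir h
  dir_bar h := G.dir_bar h
  color := G.collapseColor x hx
  two_le_valence t := by
    classical
    by_cases ht : (G.vert (G.bar x)).succAbove t = G.vert x
    · have h1 := G.two_le_valence (G.vert x)
      have h2 := G.two_le_valence (G.vert (G.bar x))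
      rw [← Nat.card_congr (G.mergedLegs x hx t ht), Nat.card_sum]
      simp only [Nat.card_eq_fintype_card, ne_eq, Fintype.card_subtype_compl,
        Fintype.card_unique] at *
      omega
    · rw [← Nat.card_congr (G.otherLegs x hx t ht)]
      exact G.two_le_valence _

/-- The chain `𝐗_e` for the edge `e = {x, bar x}`, zero if `e` is a loop. The rule for the orientation
is: if `w` is first and `v` is second in the ordering of the vertices and `e` is directed from `w` to
`v`, then the merged vertex is first and the rest is unchanged. Moving `w` to the first place costs
`(-1) ^ w`, directing `e` from `w = vert (bar x)` costs `dir (bar x)`, and afterwards moving `v` to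
the second place, or the merged vertex to the first one, costs the same sign. -/
def collapseTerm : ChainGroup P k :=
  if hx : G.vert x ≠ G.vert (G.bar x) then
    ((((-1) ^ (G.vert (G.bar x) : ℕ) * G.dir (G.bar x) : ℤˣ) : ℤ) : ℝ) • (G.collapse x hx).toChain
  else 0

/-- The pairing `π_{xy}`: it pairs `x` with `y` and `bar x` with `bar y` and agrees with `bar` elsewhere. -/
def reglueBar {H : Type} [DecidableEq H] (bar : H → H) (x y h : H) : H :=
  if h = x then y else if h = y then x else
    if h = bar x then bar y else if h = bar y then bar x else bar h

/-- The directions of the edges of the reglued graph, for an orientation represented so that `x` and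
`bar y` are initial: a new edge joins an initial to a terminal half-edge, and is directed from the
initial to the terminal one. Hence the edge `{x, y}` is directed from `x` to `y` and the edge
`{bar x, bar y}` from `bar y` to `bar x`. -/
def reglueDir {H : Type} [DecidableEq H] (bar : H → H) (dir : H → ℤˣ) (x y h : H) : ℤˣ :=
  if h = x then 1 else if h = y then -1 else
    if h = bar y then 1 else if h = bar x then -1 else dir h

theorem reglueBar_reglueBar {H : Type} [DecidableEq H] (bar : H → H) (x y : H)
    (h₁ : ∀ h, bar (bar h) = h) (h₂ : ∀ h, bar h ≠ h) (hxy : y ≠ x ∧ y ≠ bar x) (h : H) :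
    reglueBar bar x y (reglueBar bar x y h) = h := by
  unfold reglueBar
  grind

theorem reglueBar_ne {H : Type} [DecidableEq H] (bar : H → H) (x y : H)
    (h₁ : ∀ h, bar (bar h) = h) (h₂ : ∀ h, bar h ≠ h) (hxy : y ≠ x ∧ y ≠ bar x) (h : H) :
    reglueBar bar x y h ≠ h := by
  unfold reglueBar
  grind

theorem reglueDir_reglueBar {H : Type} [DecidableEq H] (bar : H → H) (dir : H → ℤˣ) (x y : H)
    (h₁ : ∀ h, bar (bar h) = h) (h₂ : ∀ h, bar h ≠ h) (h₃ : ∀ h, dir (bar h) = -dir h)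
    (hxy : y ≠ x ∧ y ≠ bar x) (h : H) :
    reglueDir bar dir x y (reglueBar bar x y h) = -reglueDir bar dir x y h := by
  have a1 : bar x ≠ bar y := fun e => hxy.1 (by rw [← h₁ y, ← e, h₁])
  have a2 : bar y ≠ x := fun e => hxy.2 (by rw [← e, h₁])
  have b1 := h₂ x
  have b2 := h₂ y
  by_cases c1 : h = x
  · simp [reglueBar, reglueDir, c1, hxy.1]
  by_cases c2 : h = y
  · simp [reglueBar, reglueDir, c2, hxy.1]
  by_cases c3 : h = bar x
  · subst c3
    simp [reglueBar, reglueDir, c1, c2, a1, a2, b2]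
  by_cases c4 : h = bar y
  · subst c4
    simp [reglueBar, reglueDir, c1, c2, c3, a1, hxy.2.symm, b1]
  have d1 : bar h ≠ x := fun e => c3 (by rw [← e, h₁])
  have d2 : bar h ≠ y := fun e => c4 (by rw [← e, h₁])
  have d3 : bar h ≠ bar x := fun e => c1 (by rw [← h₁ h, e, h₁])
  have d4 : bar h ≠ bar y := fun e => c2 (by rw [← h₁ h, e, h₁])
  simp [reglueBar, reglueDir, c1, c2, c3, c4, d1, d2, d3, d4, h₃]

/-- The reglued `𝒪`-graph, where the orientation of `G` is first represented so that `x` and `bar y`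
are initial. The sign of this change of representative is in `hTerm`. -/
def reglue (G : OGraph P k) (x y : G.H) (hxy : y ≠ x ∧ y ≠ G.bar x) : OGraph P k where
  H := G.H
  vert := G.vert
  bar := reglueBar G.bar x y
  bar_bar := reglueBar_reglueBar G.bar x y G.bar_bar G.bar_ne hxy
  bar_ne := reglueBar_ne G.bar x y G.bar_bar G.bar_ne hxy
  dir := reglueDir G.bar G.dir x y
  dir_bar := reglueDir_reglueBar G.bar G.dir x y G.bar_bar G.bar_ne G.dir_bar hxy
  color := G.color
  two_le_valence := G.two_le_valence

theorem Iso.color_eq' {G G' : OGraph P k} (f : Iso G G') {v v' : Fin k} (hv : f.onVert v = v') :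
    G'.color v' =
      CyclicOperad.Spider.map (fiberEquiv f.onVert f.onHalf f.vert_eq hv) (G.color v) := by
  subst hv
  exact f.color_eq v

def restrictPerm (σ : Equiv.Perm (Fin (k + 1))) (w w' : Fin (k + 1)) (hw : σ w = w') :
    Equiv.Perm (Fin k) :=
  (finSuccAboveEquiv w).trans ((σ.subtypeEquiv fun u => by
    rw [← hw, Ne, Ne, σ.injective.eq_iff]).trans (finSuccAboveEquiv w').symm)

theorem succAbove_restrictPerm (σ : Equiv.Perm (Fin (k + 1))) (w w' : Fin (k + 1)) (hw : σ w = w')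
    (t : Fin k) : w'.succAbove (restrictPerm σ w w' hw t) = σ (w.succAbove t) := by
  have := congrArg Subtype.val ((finSuccAboveEquiv w').apply_symm_apply
    ((σ.subtypeEquiv (p := (· ≠ w)) (q := (· ≠ w')) fun u => by
      rw [← hw, Ne, Ne, σ.injective.eq_iff]) (finSuccAboveEquiv w t)))
  rw [finSuccAboveEquiv_apply] at this
  exact this

theorem sign_restrictPerm (σ : Equiv.Perm (Fin (k + 1))) (w w' : Fin (k + 1)) (hw : σ w = w') :
    Equiv.Perm.sign σ =
      (-1) ^ (w : ℕ) * (-1) ^ (w' : ℕ) * Equiv.Perm.sign (restrictPerm σ w w' hw) := by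
  have key : Equiv.Perm.decomposeFin.symm (0, restrictPerm σ w w' hw) =
      w'.cycleRange * σ * w.cycleRange⁻¹ := by
    ext i
    congr 1
    refine Fin.cases ?_ (fun t => ?_) i
    · simp [Equiv.Perm.inv_def, Fin.cycleRange_symm_zero, hw]
    · simp [Equiv.Perm.inv_def, Fin.cycleRange_symm_succ, ← succAbove_restrictPerm σ w w' hw,
        Fin.cycleRange_succAbove]
  have h2 := congrArg Equiv.Perm.sign key
  rw [Equiv.Perm.decomposeFin.symm_sign] at h2
  simp only [if_true, one_mul, map_mul, Fin.sign_cycleRange, map_inv] at h2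
  rw [h2]
  rcases neg_one_pow_eq_or ℤˣ (w : ℕ) with h | h <;>
    rcases neg_one_pow_eq_or ℤˣ (w' : ℕ) with h' | h' <;> simp [h, h']

theorem prod_split {H : Type} [Fintype H] [DecidableEq H] (r : H → ℤˣ) (x y : H) (hxy : y ≠ x) :
    ∏ h, r h = r x * r y * ∏ h : {h : H // h ≠ x ∧ h ≠ y}, r h := by
  rw [← Finset.mul_prod_erase _ _ (Finset.mem_univ x),
    ← Finset.mul_prod_erase _ _ (Finset.mem_erase.2 ⟨hxy, Finset.mem_univ y⟩), mul_assoc]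
  congr 2
  refine (Finset.prod_subtype _ (fun h => ?_) r)
  simp [and_comm]

theorem Iso.dir_pair {G G' : OGraph P k} (f : Iso G G') (x : G.H) :
    ((if G.dir x = 1 then G'.dir (f.onHalf x) else 1) *
      if G.dir (G.bar x) = 1 then G'.dir (f.onHalf (G.bar x)) else 1) =
    G.dir (G.bar x) * G'.dir (G'.bar (f.onHalf x)) := by
  rw [← f.bar_eq, G.dir_bar, G'.dir_bar]
  rcases Int.units_eq_one_or (G.dir x) with h | h <;> simp [h]

variable {G : OGraph P (k + 1)} {x : G.H}

theorem collapse_vert_eq {G' : OGraph P (k + 1)} (f : Iso G G')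
    (hx : G.vert x ≠ G.vert (G.bar x))
    (hx' : G'.vert (f.onHalf x) ≠ G'.vert (G'.bar (f.onHalf x)))
    (hw : f.onVert (G.vert (G.bar x)) = G'.vert (G'.bar (f.onHalf x))) (u : Fin (k + 1)) :
    mergeVert _ _ hx' (f.onVert u) = restrictPerm f.onVert _ _ hw (mergeVert _ _ hx u) := by
  rw [mergeVert_eq_iff, succAbove_restrictPerm, succAbove_mergeVert, ← hw, f.vert_eq]
  simp only [f.onVert.injective.eq_iff]
  split_ifs <;> rfl

theorem collapseColor_iso {G' : OGraph P (k + 1)} (f : Iso G G')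
    (hx : G.vert x ≠ G.vert (G.bar x))
    (hx' : G'.vert (f.onHalf x) ≠ G'.vert (G'.bar (f.onHalf x)))
    (hw : f.onVert (G.vert (G.bar x)) = G'.vert (G'.bar (f.onHalf x)))
    (g : {h : G.H // h ≠ x ∧ h ≠ G.bar x} ≃
      {h : G'.H // h ≠ f.onHalf x ∧ h ≠ G'.bar (f.onHalf x)})
    (hg : ∀ h, (g h : G'.H) = f.onHalf h)
    (hv : ∀ h, mergeVert _ _ hx' (G'.vert (g h)) =
      restrictPerm f.onVert _ _ hw (mergeVert _ _ hx (G.vert h))) (t : Fin k) :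
    G'.collapseColor (f.onHalf x) hx' (restrictPerm f.onVert _ _ hw t) =
      CyclicOperad.Spider.map (fiberEquiv (restrictPerm f.onVert _ _ hw) g hv rfl)
        (G.collapseColor x hx t) := by
  have hs := succAbove_restrictPerm f.onVert _ _ hw t
  have hv := f.vert_eq x
  by_cases ht : (G.vert (G.bar x)).succAbove t = G.vert x
  · have ht' : (G'.vert (G'.bar (f.onHalf x))).succAbove (restrictPerm f.onVert _ _ hw t) =
        G'.vert (f.onHalf x) := by rw [hs, ht, hv]
    rw [collapseColor, collapseColor, dif_pos ht, dif_pos ht', f.color_eq' hv.symm, f.color_eq' hw,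
      CyclicOperad.Spider.mate_map (fiberEquiv f.onVert f.onHalf f.vert_eq hv.symm)
        (fiberEquiv f.onVert f.onHalf f.vert_eq hw) (⟨x, rfl⟩ : {h : G.H // G.vert h = G.vert x})
        (⟨G.bar x, rfl⟩ : {h : G.H // G.vert h = G.vert (G.bar x)}) ⟨f.onHalf x, rfl⟩
        ⟨G'.bar (f.onHalf x), rfl⟩ rfl (Subtype.ext (f.bar_eq x).symm),
      CyclicOperad.Spider.map_map, CyclicOperad.Spider.map_map]
    congr 2
    ext a
    refine Eq.trans ?_ (hg (G.mergedLegs x hx t ht a).1).symm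
    rcases a with a | a <;> rfl
  · have ht' : ¬ (G'.vert (G'.bar (f.onHalf x))).succAbove (restrictPerm f.onVert _ _ hw t) =
        G'.vert (f.onHalf x) := by rwa [hs, hv, f.onVert.injective.eq_iff]
    rw [collapseColor, collapseColor, dif_neg ht, dif_neg ht', f.color_eq' hs.symm,
      CyclicOperad.Spider.map_map, CyclicOperad.Spider.map_map]
    congr 2
    ext a
    exact (hg (G.otherLegs x hx t ht a).1).symm

def collapseIso {G' : OGraph P (k + 1)} (f : Iso G G')
    (hx : G.vert x ≠ G.vert (G.bar x))
    (hx' : G'.vert (f.onHalf x) ≠ G'.vert (G'.bar (f.onHalf x)))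
    (hw : f.onVert (G.vert (G.bar x)) = G'.vert (G'.bar (f.onHalf x))) :
    Iso (G.collapse x hx) (G'.collapse (f.onHalf x) hx') where
  onVert := restrictPerm f.onVert _ _ hw
  onHalf := f.onHalf.subtypeEquiv fun h => by
    rw [f.bar_eq, Ne, Ne, Ne, Ne, f.onHalf.injective.eq_iff, f.onHalf.injective.eq_iff]
  vert_eq h := (congrArg (mergeVert _ _ hx') (f.vert_eq h.1)).trans
    (collapse_vert_eq f hx hx' hw (G.vert h.1))
  bar_eq h := Subtype.ext (f.bar_eq h.1)
  color_eq := collapseColor_iso f hx hx' hw _ (fun _ => rfl) _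

theorem collapseIso_sign {G' : OGraph P (k + 1)} (f : Iso G G')
    (hx : G.vert x ≠ G.vert (G.bar x))
    (hx' : G'.vert (f.onHalf x) ≠ G'.vert (G'.bar (f.onHalf x)))
    (hw : f.onVert (G.vert (G.bar x)) = G'.vert (G'.bar (f.onHalf x))) :
    f.sign = ((-1) ^ (G.vert (G.bar x) : ℕ) * G.dir (G.bar x)) *
      ((-1) ^ (G'.vert (G'.bar (f.onHalf x)) : ℕ) * G'.dir (G'.bar (f.onHalf x))) *
      (collapseIso f hx hx' hw).sign := by
  have h1 := sign_restrictPerm f.onVert _ _ hw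
  have h2 := prod_split (fun h => if G.dir h = 1 then G'.dir (f.onHalf h) else 1) x (G.bar x)
    (G.bar_ne x)
  rw [f.dir_pair x] at h2
  rw [Iso.sign, h1, h2, Iso.sign]
  have h3 : (∏ h : {h : G.H // h ≠ x ∧ h ≠ G.bar x},
        if G.dir h = 1 then G'.dir (f.onHalf h) else 1) =
      ∏ h : (G.collapse x hx).H, if (G.collapse x hx).dir h = 1 then
        (G'.collapse (f.onHalf x) hx').dir ((collapseIso f hx hx' hw).onHalf h) else 1 := rfl
  have h4 : restrictPerm f.onVert _ _ hw = (collapseIso f hx hx' hw).onVert := rfl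
  rw [h3, h4]
  ac_rfl

theorem collapseTerm_iso {G' : OGraph P (k + 1)} (f : Iso G G') (x : G.H) :
    G.collapseTerm x = ((f.sign : ℤ) : ℝ) • G'.collapseTerm (f.onHalf x) := by
  have hw : f.onVert (G.vert (G.bar x)) = G'.vert (G'.bar (f.onHalf x)) := by
    rw [f.bar_eq, f.vert_eq]
  by_cases hx : G.vert x ≠ G.vert (G.bar x)
  · have hx' : G'.vert (f.onHalf x) ≠ G'.vert (G'.bar (f.onHalf x)) := by
      rwa [← hw, f.vert_eq, Ne, f.onVert.injective.eq_iff]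
    rw [collapseTerm, collapseTerm, dif_pos hx, dif_pos hx', toChain_iso (collapseIso f hx hx' hw),
      smul_smul, smul_smul, collapseIso_sign f hx hx' hw]
    congr 1
    generalize (-1) ^ (G.vert (G.bar x) : ℕ) * G.dir (G.bar x) = s
    generalize (-1) ^ (G'.vert (G'.bar (f.onHalf x)) : ℕ) * G'.dir (G'.bar (f.onHalf x)) = s'
    rcases Int.units_eq_one_or s with h | h <;> rcases Int.units_eq_one_or s' with h' | h' <;>
      simp [h, h']
  · have hx' : ¬ G'.vert (f.onHalf x) ≠ G'.vert (G'.bar (f.onHalf x)) := by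
      rwa [← hw, f.vert_eq, Ne, f.onVert.injective.eq_iff]
    rw [collapseTerm, collapseTerm, dif_neg hx, dif_neg hx', smul_zero]

def recolor (G : OGraph P k) (c : ∀ v : Fin k, P.Spider {h : G.H // G.vert h = v}) :
    OGraph P k :=
  { G with color := c }

theorem collapse_setColor (G : OGraph P (k + 1)) (x : G.H) (hx : G.vert x ≠ G.vert (G.bar x))
    (v : Fin (k + 1)) :
    ∃ (t : Fin k) (Λ : P.Spider {h : G.H // G.vert h = v} →ₗ[ℝ]
        P.Spider {h : (G.collapse x hx).H // (G.collapse x hx).vert h = t}),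
      ∀ S, (G.setColor v S).collapse x hx = (G.collapse x hx).setColor t (Λ S) := by
  suffices h : ∃ (t : Fin k) (Λ : P.Spider {h : G.H // G.vert h = v} →ₗ[ℝ]
      P.Spider {h : {h : G.H // h ≠ x ∧ h ≠ G.bar x} // mergeVert _ _ hx (G.vert h) = t}),
      ∀ S, (G.setColor v S).collapseColor x hx = Function.update (G.collapseColor x hx) t (Λ S) by
    obtain ⟨t, Λ, h⟩ := h
    exact ⟨t, Λ, fun S => congrArg (G.collapse x hx).recolor (h S)⟩
  by_cases h1 : v = G.vert x
  · subst h1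
    obtain ⟨t, ht⟩ := Fin.exists_succAbove_eq hx
    refine ⟨t, CyclicOperad.Spider.map (G.mergedLegs x hx t ht) ∘ₗ
      (CyclicOperad.Spider.mate (⟨x, rfl⟩ : {h : G.H // G.vert h = G.vert x})
        (⟨G.bar x, rfl⟩ : {h : G.H // G.vert h = G.vert (G.bar x)})).flip (G.color (G.vert (G.bar x))),
      fun S => funext fun s => ?_⟩
    by_cases hs : s = t
    · subst hs
      rw [Function.update_self]
      have e1 : (G.setColor (G.vert x) S).color (G.vert x) = S := Function.update_self ..
      have e2 : (G.setColor (G.vert x) S).color (G.vert (G.bar x)) = G.color (G.vert (G.bar x)) :=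
        Function.update_of_ne hx.symm ..
      refine (dif_pos ht).trans ?_
      exact congrArg (CyclicOperad.Spider.map (G.mergedLegs x hx s ht)) (congrArg₂
        (fun A B => CyclicOperad.Spider.mate (⟨x, rfl⟩ : {h : G.H // G.vert h = G.vert x})
          (⟨G.bar x, rfl⟩ : {h : G.H // G.vert h = G.vert (G.bar x)}) A B) e1 e2)
    · have hs' : (G.vert (G.bar x)).succAbove s ≠ G.vert x := fun e => hs
        (Fin.succAbove_right_injective (e.trans ht.symm))
      rw [Function.update_of_ne hs, collapseColor, dif_neg hs']
      refine (dif_neg hs').trans ?_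
      exact congrArg (CyclicOperad.Spider.map (G.otherLegs x hx s hs')) (Function.update_of_ne hs' ..)
  · by_cases h2 : v = G.vert (G.bar x)
    · subst h2
      obtain ⟨t, ht⟩ := Fin.exists_succAbove_eq hx
      refine ⟨t, CyclicOperad.Spider.map (G.mergedLegs x hx t ht) ∘ₗ
        (CyclicOperad.Spider.mate (⟨x, rfl⟩ : {h : G.H // G.vert h = G.vert x})
          (⟨G.bar x, rfl⟩ : {h : G.H // G.vert h = G.vert (G.bar x)})) (G.color (G.vert x)),
        fun S => funext fun s => ?_⟩
      by_cases hs : s = t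
      · subst hs
        rw [Function.update_self]
        have e1 : (G.setColor (G.vert (G.bar x)) S).color (G.vert (G.bar x)) = S :=
          Function.update_self ..
        have e2 : (G.setColor (G.vert (G.bar x)) S).color (G.vert x) = G.color (G.vert x) :=
          Function.update_of_ne hx ..
        refine (dif_pos ht).trans ?_
        exact congrArg (CyclicOperad.Spider.map (G.mergedLegs x hx s ht)) (congrArg₂
          (fun A B => CyclicOperad.Spider.mate (⟨x, rfl⟩ : {h : G.H // G.vert h = G.vert x})
            (⟨G.bar x, rfl⟩ : {h : G.H // G.vert h = G.vert (G.bar x)}) A B) e2 e1)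
      · have hs' : (G.vert (G.bar x)).succAbove s ≠ G.vert x := fun e => hs
          (Fin.succAbove_right_injective (e.trans ht.symm))
        rw [Function.update_of_ne hs, collapseColor, dif_neg hs']
        refine (dif_neg hs').trans ?_
        exact congrArg (CyclicOperad.Spider.map (G.otherLegs x hx s hs'))
          (Function.update_of_ne (Fin.succAbove_ne _ _) ..)
    · obtain ⟨t, rfl⟩ := Fin.exists_succAbove_eq h2
      refine ⟨t, CyclicOperad.Spider.map (G.otherLegs x hx t h1), fun S => funext fun s => ?_⟩
      by_cases hs : s = t
      · subst hs
        rw [Function.update_self]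
        refine (dif_neg h1).trans ?_
        exact congrArg (CyclicOperad.Spider.map (G.otherLegs x hx s h1)) (Function.update_self ..)
      · rw [Function.update_of_ne hs]
        by_cases hs' : (G.vert (G.bar x)).succAbove s = G.vert x
        · rw [collapseColor, dif_pos hs']
          refine (dif_pos hs').trans ?_
          exact congrArg (CyclicOperad.Spider.map (G.mergedLegs x hx s hs')) (congrArg₂
            (fun A B => CyclicOperad.Spider.mate (⟨x, rfl⟩ : {h : G.H // G.vert h = G.vert x})
              (⟨G.bar x, rfl⟩ : {h : G.H // G.vert h = G.vert (G.bar x)}) A B)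
            (Function.update_of_ne (Ne.symm h1) ..) (Function.update_of_ne (Ne.symm h2) ..))
        · rw [collapseColor, dif_neg hs']
          refine (dif_neg hs').trans ?_
          exact congrArg (CyclicOperad.Spider.map (G.otherLegs x hx s hs'))
            (Function.update_of_ne (fun e => hs (Fin.succAbove_right_injective e)) ..)

theorem collapseTerm_linear (G : OGraph P (k + 1)) (x : G.H) (v : Fin (k + 1)) (a b : ℝ)
    (S T : P.Spider {h : G.H // G.vert h = v}) :
    (G.setColor v (a • S + b • T)).collapseTerm x =
      a • (G.setColor v S).collapseTerm x + b • (G.setColor v T).collapseTerm x := by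
  by_cases hx : G.vert x ≠ G.vert (G.bar x)
  · obtain ⟨t, Λ, h⟩ := G.collapse_setColor x hx v
    have key : ∀ S, (G.setColor v S).collapseTerm x =
        ((((-1) ^ (G.vert (G.bar x) : ℕ) * G.dir (G.bar x) : ℤˣ) : ℤ) : ℝ) •
          ((G.collapse x hx).setColor t (Λ S)).toChain := fun S => by
      rw [← h S]
      exact dif_pos hx
    rw [key, key, key, map_add, map_smul, map_smul, toChain_linear, smul_add, smul_comm a,
      smul_comm b]
  · have key : ∀ S, (G.setColor v S).collapseTerm x = 0 := fun S => dif_neg hx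
    rw [key, key, key, smul_zero, smul_zero, add_zero]

theorem reglue_bar_iso {G G' : OGraph P k} (f : Iso G G') (x y h : G.H) :
    reglueBar G'.bar (f.onHalf x) (f.onHalf y) (f.onHalf h) =
      f.onHalf (reglueBar G.bar x y h) := by
  simp only [reglueBar, f.bar_eq, f.onHalf.injective.eq_iff]
  split_ifs <;> rfl

def reglueIso {G G' : OGraph P k} (f : Iso G G') (x y : G.H) (hxy : y ≠ x ∧ y ≠ G.bar x)
    (hxy' : f.onHalf y ≠ f.onHalf x ∧ f.onHalf y ≠ G'.bar (f.onHalf x)) :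
    Iso (G.reglue x y hxy) (G'.reglue (f.onHalf x) (f.onHalf y) hxy') where
  onVert := f.onVert
  onHalf := f.onHalf
  vert_eq := f.vert_eq
  bar_eq := reglue_bar_iso f x y
  color_eq := f.color_eq

theorem reglueIso_sign {G G' : OGraph P k} (f : Iso G G') (x y : G.H)
    (hxy : y ≠ x ∧ y ≠ G.bar x)
    (hxy' : f.onHalf y ≠ f.onHalf x ∧ f.onHalf y ≠ G'.bar (f.onHalf x)) :
    f.sign = (G.dir x * G.dir (G.bar y)) *
      (G'.dir (f.onHalf x) * G'.dir (G'.bar (f.onHalf y))) * (reglueIso f x y hxy hxy').sign := by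
  have a1 : G.bar x ≠ G.bar y := fun e => hxy.1 (by rw [← G.bar_bar y, ← e, G.bar_bar])
  have a2 : x ≠ G.bar y := fun e => hxy.2 (by rw [e, G.bar_bar])
  have b1 := G.bar_ne x
  have b2 := G.bar_ne y
  set s : Finset G.H := {x, G.bar x, y, G.bar y} with hs
  have hprod : ∀ r : G.H → ℤˣ, ∏ h, r h =
      (r x * r (G.bar x)) * (r y * r (G.bar y)) * ∏ h ∈ sᶜ, r h := fun r => by
    rw [← Finset.prod_mul_prod_compl s, hs, Finset.prod_insert, Finset.prod_insert,
      Finset.prod_insert, Finset.prod_singleton]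
    · ac_rfl
    · simpa using b2.symm
    · simp [a1, hxy.2.symm]
    · simp [a2, hxy.1.symm, b1.symm]
  have e1 : f.sign = Equiv.Perm.sign f.onVert *
      ((G.dir (G.bar x) * G'.dir (G'.bar (f.onHalf x))) *
        (G.dir (G.bar y) * G'.dir (G'.bar (f.onHalf y))) *
        ∏ h ∈ sᶜ, if G.dir h = 1 then G'.dir (f.onHalf h) else 1) := by
    rw [Iso.sign, hprod, f.dir_pair, f.dir_pair]
  have hdir : ∀ h, reglueDir G'.bar G'.dir (f.onHalf x) (f.onHalf y) (f.onHalf h) =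
      if h = x then 1 else if h = y then -1 else
        if h = G.bar y then 1 else if h = G.bar x then -1 else G'.dir (f.onHalf h) := fun h => by
    simp only [reglueDir, f.bar_eq, f.onHalf.injective.eq_iff]
  have e2 : (reglueIso f x y hxy hxy').sign = Equiv.Perm.sign f.onVert *
      ∏ h ∈ sᶜ, if G.dir h = 1 then G'.dir (f.onHalf h) else 1 := by
    have : (reglueIso f x y hxy hxy').sign = Equiv.Perm.sign f.onVert *
      ∏ h : G.H, if reglueDir G.bar G.dir x y h = 1 then
        reglueDir G'.bar G'.dir (f.onHalf x) (f.onHalf y) (f.onHalf h) else 1 := rfl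
    rw [this, hprod]
    simp only [hdir]
    have h4 : ∀ (h : G.H), h ∈ sᶜ → (h ≠ x ∧ h ≠ G.bar x ∧ h ≠ y ∧ h ≠ G.bar y) := fun h hh => by
      simpa [hs] using hh
    rw [Finset.prod_congr rfl (g := fun h => if G.dir h = 1 then G'.dir (f.onHalf h) else 1)
      fun h hh => by
        obtain ⟨c1, c2, c3, c4⟩ := h4 h hh
        simp [reglueDir, c1, c2, c3, c4]]
    simp [reglueDir, a1, a2.symm, b1, b2, hxy.1, hxy.2.symm]
  rw [e1, e2, G.dir_bar x, G'.dir_bar (f.onHalf x), neg_mul_neg]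
  ac_rfl

/-- The chain `(𝐗^{π_{xy}})_{x ∪ y}`, for distinct half-edges `x`, `y` that do not form an edge. The sign
`dir x * dir (bar y)` comes from directing the edges of `x` and `y` so that `x` and `bar y` are
initial. -/
def hTerm (G : OGraph P (k + 1)) (x y : G.H) : ChainGroup P k :=
  if hxy : y ≠ x ∧ y ≠ G.bar x then
    (((G.dir x * G.dir (G.bar y) : ℤˣ) : ℤ) : ℝ) • (G.reglue x y hxy).collapseTerm x
  else 0

theorem hTerm_iso {G G' : OGraph P (k + 1)} (f : Iso G G') (x y : G.H) :
    G.hTerm x y = ((f.sign : ℤ) : ℝ) • G'.hTerm (f.onHalf x) (f.onHalf y) := by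
  have iff : (y ≠ x ∧ y ≠ G.bar x) ↔
      (f.onHalf y ≠ f.onHalf x ∧ f.onHalf y ≠ G'.bar (f.onHalf x)) := by
    rw [f.bar_eq, Ne, Ne, Ne, Ne, f.onHalf.injective.eq_iff, f.onHalf.injective.eq_iff]
  by_cases hxy : y ≠ x ∧ y ≠ G.bar x
  · have hxy' := iff.1 hxy
    have := collapseTerm_iso (reglueIso f x y hxy hxy') x
    rw [hTerm, hTerm, dif_pos hxy, dif_pos hxy', this, smul_smul, smul_smul,
      reglueIso_sign f x y hxy hxy']
    refine congrArg₂ (· • ·) ?_ rfl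
    generalize G.dir x * G.dir (G.bar y) = s
    generalize G'.dir (f.onHalf x) * G'.dir (G'.bar (f.onHalf y)) = s'
    rcases Int.units_eq_one_or s with h | h <;> rcases Int.units_eq_one_or s' with h' | h' <;>
      simp [h, h']
  · rw [hTerm, hTerm, dif_neg hxy, dif_neg (fun h => hxy (iff.2 h)), smul_zero]

theorem hTerm_linear (G : OGraph P (k + 1)) (x y : G.H) (v : Fin (k + 1)) (a b : ℝ)
    (S T : P.Spider {h : G.H // G.vert h = v}) :
    (G.setColor v (a • S + b • T)).hTerm x y =
      a • (G.setColor v S).hTerm x y + b • (G.setColor v T).hTerm x y := by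
  by_cases hxy : y ≠ x ∧ y ≠ G.bar x
  · have key : ∀ S, (G.setColor v S).hTerm x y =
        (((G.dir x * G.dir (G.bar y) : ℤˣ) : ℤ) : ℝ) •
          ((G.reglue x y hxy).setColor v S).collapseTerm x := fun S => dif_pos hxy
    have := (G.reglue x y hxy).collapseTerm_linear x v a b S T
    rw [key, key, key, smul_comm a, smul_comm b, ← smul_add]
    exact congrArg _ this
  · have key : ∀ S, (G.setColor v S).hTerm x y = 0 := fun S => dif_neg hxy
    rw [key, key, key, smul_zero, smul_zero, add_zero]

theorem sum_iso {M : Type*} [AddCommGroup M] [Module ℝ M] {I J : Type} [Fintype I] [Fintype J]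
    (e : I ≃ J) (c r : ℝ) (F : I → M) (F' : J → M) (h : ∀ i, F i = c • F' (e i)) :
    r • ∑ i, F i = c • r • ∑ j, F' j := by
  rw [smul_comm c, Finset.smul_sum (r := c), Fintype.sum_equiv e F (fun j => c • F' j) h]

theorem sum_linear {M : Type*} [AddCommGroup M] [Module ℝ M] {I : Type} [Fintype I]
    (a b r : ℝ) (F F₁ F₂ : I → M) (h : ∀ i, F i = a • F₁ i + b • F₂ i) :
    r • ∑ i, F i = a • r • ∑ i, F₁ i + b • r • ∑ i, F₂ i := by
  rw [smul_comm a, smul_comm b, ← smul_add, Finset.smul_sum (r := a), Finset.smul_sum (r := b),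
    ← Finset.sum_add_distrib, Finset.sum_congr rfl fun i _ => h i]

variable (P k) in
/-- The boundary `∂_E`, the sum of `𝐗_e` over all edges `e`. Every edge is `{x, bar x}` for exactly
two half-edges `x`, which explains the factor `1 / 2`. -/
def edgeBoundaryAt : ChainGroup P (k + 1) →ₗ[ℝ] ChainGroup P k :=
  liftChain (fun G => (1 / 2 : ℝ) • ∑ x : G.H, G.collapseTerm x)
    (fun _ _ f => sum_iso f.onHalf _ _ _ _ (collapseTerm_iso f))
    (fun G v a b S T => sum_linear (I := G.H) a b _ _ _ _
      fun x => G.collapseTerm_linear x v a b S T)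

variable (P k) in
/-- The boundary `∂_H`, the sum of `(𝐗^{π_{xy}})_{x ∪ y}` over all unordered pairs of distinct
half-edges `x`, `y` with `x ≠ bar y`. Every pair occurs in two orders, which explains the factor
`1 / 2`. -/
def hBoundaryAt : ChainGroup P (k + 1) →ₗ[ℝ] ChainGroup P k :=
  liftChain (fun G => (1 / 2 : ℝ) • ∑ p : G.H × G.H, G.hTerm p.1 p.2)
    (fun _ _ f => sum_iso (f.onHalf.prodCongr f.onHalf) _ _ _ _ fun p => hTerm_iso f p.1 p.2)
    (fun G v a b S T => sum_linear (I := G.H × G.H) a b _ _ _ _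
      fun p => G.hTerm_linear p.1 p.2 v a b S T)

theorem edgeBoundaryAt_toChain (G : OGraph P (k + 1)) :
    edgeBoundaryAt P k G.toChain = (1 / 2 : ℝ) • ∑ x : G.H, G.collapseTerm x :=
  liftChain_toChain _ _ _ G

theorem hBoundaryAt_toChain (G : OGraph P (k + 1)) :
    hBoundaryAt P k G.toChain = (1 / 2 : ℝ) • ∑ p : G.H × G.H, G.hTerm p.1 p.2 :=
  liftChain_toChain _ _ _ G

end OGraph

open scoped DirectSum

/-- The `𝒪`-graph complex, graded by the number of vertices. -/
abbrev GraphComplex (P : CyclicOperad.{u}) : Type (max u 1) := ⨁ k : ℕ, ChainGroup P k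

/-- The endomorphism of degree `-1` of the graph complex with given components, zero on degree `0`. -/
def lowerDegree (P : CyclicOperad.{u}) (d : ∀ k, ChainGroup P (k + 1) →ₗ[ℝ] ChainGroup P k) :
    GraphComplex P →ₗ[ℝ] GraphComplex P :=
  DirectSum.toModule ℝ ℕ (GraphComplex P) fun
    | 0 => 0
    | k + 1 => DirectSum.lof ℝ ℕ (ChainGroup P) k ∘ₗ d k

/-- The edge-collapse boundary `∂_E`. -/
def edgeBoundary (P : CyclicOperad.{u}) : GraphComplex P →ₗ[ℝ] GraphComplex P :=
  lowerDegree P (OGraph.edgeBoundaryAt P)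

/-- The H-boundary `∂_H`. -/
def hBoundary (P : CyclicOperad.{u}) : GraphComplex P →ₗ[ℝ] GraphComplex P :=
  lowerDegree P (OGraph.hBoundaryAt P)

end

/-! Everything rests on one sign. Mating of spiders is symmetric (by the rotation axiom of the
cyclic operad) and associative (by sequential associativity), so collapsing two edges in either
order gives isomorphic graphs. The order is visible only in the vertex numbering: deleting the
vertices in positions `b` and `d` costs signs that depend on which is deleted first, because the
first deletion shifts one of the two positions by one. Hence two collapses anticommute
(`doubleCollapse_comm`), which includes the degenerate cases of loops and parallel edges, where both
sides vanish.

The second ingredient is that collapsing an edge commutes with cutting and regluing two other edges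
(`collapseReglueIso`). Therefore every composite of two boundaries is a sum of double collapses in a
graph reglued once or twice beforehand.

For (a), the terms are indexed by two pairs `(x, y)`, `(z, w)`: reglue at both, then collapse the
edge `x ∪ y` and after it `z ∪ w`. Regluing at both pairs in the other order gives the same graph,
with the same orientation once all signs are counted (`reglueDir_reglueDir_comm`). Interchanging the
pairs thus only exchanges the two collapses, and the sum equals its own negative (`hhTerm_swap`).

For (b), take a pair `(x, y)` and an edge `z`. If `z` is none of the edges cut, its collapse
commutes with the regluing, and the terms of the two composites cancel by anticommutation. What is
left of the composite "H-boundary, then edge boundary" are the terms in which the collapsed edges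
are the two new ones, `{x, y}` and `{bar x, bar y}`. The pairs `(x, y)` and `(bar y, bar x)` define
the same oriented reglued graph but collapse these two edges in opposite orders, so these terms
cancel in pairs (`heTerm_bar_right`, `sum_heTerm_bar`). -/

noncomputable section

/-! ### Symmetry and associativity of mating -/

namespace CyclicOperad.Spider

variable {P : CyclicOperad.{u}} {A B C H H' : Type}

theorem map_id (S : P.Spider A) : map (Equiv.refl A) S = S := by
  have : (map (Equiv.refl A) : P.Spider A →ₗ[ℝ] P.Spider A) = LinearMap.id :=
    hom_ext fun m L o => by simp
  exact LinearMap.congr_fun this S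

/-- In the coinvariants a generator may be rewritten with any labeling in its orbit, so linear maps
need only be compared on generators with a conveniently normalized labeling. -/
theorem hom_ext_of_exists {M : Type*} [AddCommGroup M] [Module ℝ M] {f g : P.Spider A →ₗ[ℝ] M}
    (p : ∀ m : ℕ, (A ≃ Fin (m + 2)) → Prop)
    (hp : ∀ (m : ℕ) (L : A ≃ Fin (m + 2)), ∃ σ : Equiv.Perm (Fin (m + 2)), p m (L.trans σ))
    (h : ∀ (m : ℕ) (L : A ≃ Fin (m + 2)) (o : P.O m), p m L → f (mk L o) = g (mk L o)) :
    f = g := by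
  refine hom_ext fun m L o => ?_
  obtain ⟨σ, hσ⟩ := hp m L
  rw [← mk_act L σ o]
  exact h m _ _ hσ

theorem exists_relabel_zero {m : ℕ} (a : A) (L : A ≃ Fin (m + 2)) :
    ∃ σ : Equiv.Perm (Fin (m + 2)), (L.trans σ) a = 0 :=
  ⟨Equiv.swap (L a) 0, by simp⟩

theorem exists_relabel_one {m : ℕ} (a : A) (L : A ≃ Fin (m + 2)) :
    ∃ σ : Equiv.Perm (Fin (m + 2)), (L.trans σ) a = 1 :=
  ⟨Equiv.swap (L a) 1, by simp⟩

theorem exists_relabel_zero_one {m : ℕ} (a b : A) (hab : a ≠ b) (L : A ≃ Fin (m + 2)) :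
    ∃ σ : Equiv.Perm (Fin (m + 2)), (L.trans σ) a = 0 ∧ (L.trans σ) b = 1 := by
  have h : Equiv.swap (L a) 0 (L b) ≠ 0 := fun e => hab (L.injective
    ((Equiv.swap (L a) 0).injective ((Equiv.swap_apply_left _ _).trans e.symm)))
  refine ⟨Equiv.swap (Equiv.swap (L a) 0 (L b)) 1 * Equiv.swap (L a) 0, ?_, ?_⟩
  · simp only [Equiv.trans_apply, Equiv.Perm.mul_apply, Equiv.swap_apply_left]
    exact Equiv.swap_apply_of_ne_of_ne h.symm (by simp)
  · simp

theorem mate_mk_of_eq (lam : A) (mu : B) {m n k : ℕ} (h : n + m = k) (L : A ≃ Fin (m + 2))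
    (K : B ≃ Fin (n + 2)) (a : P.O m) (b : P.O n) (hL : L lam = 0) (hK : K mu = 1) :
    mate lam mu (mk L a) (mk K b) = mk (mateLabel h L K lam mu hL hK) (P.comp h 0 b a) := by
  subst h
  exact mate_mk lam mu L K a b hL hK

/-- Sequential associativity of mating. -/
theorem mate_assoc (x : A) (y z : B) (w : C) (hyz : y ≠ z) (S : P.Spider A) (T : P.Spider B)
    (U : P.Spider C)
    (e : ({s : {a // a ≠ x} ⊕ {b // b ≠ y} // s ≠ Sum.inr ⟨z, hyz.symm⟩} ⊕ {c // c ≠ w}) ≃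
      ({a // a ≠ x} ⊕ {s : {b // b ≠ z} ⊕ {c // c ≠ w} // s ≠ Sum.inl ⟨y, hyz⟩}))
    (he₁ : ∀ a h, e (Sum.inl ⟨Sum.inl a, h⟩) = Sum.inl a)
    (he₂ : ∀ b h h', e (Sum.inl ⟨Sum.inr b, h⟩) = Sum.inr ⟨Sum.inl ⟨b.1, h'⟩, fun e =>
      b.2 (congrArg Subtype.val (Sum.inl_injective e))⟩)
    (he₃ : ∀ c, e (Sum.inr c) = Sum.inr ⟨Sum.inr c, Sum.inr_ne_inl⟩) :
    map e (mate (Sum.inr ⟨z, hyz.symm⟩) w (mate x y S T) U) =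
      mate x (Sum.inl ⟨y, hyz⟩) S (mate z w T U) := by
  -- By linearity in each spider, normalized generators suffice: `x` and `z` are the outputs of `a`
  -- and `b`, while `y` and `w` are the first inputs of `b` and `c`. No relabeling then intervenes
  -- in any of the four matings.
  suffices h : ∀ (m : ℕ) (L : A ≃ Fin (m + 2)) (a : P.O m), L x = 0 →
      ∀ (n : ℕ) (K : B ≃ Fin (n + 2)) (b : P.O n), K z = 0 ∧ K y = 1 →
      ∀ (q : ℕ) (M : C ≃ Fin (q + 2)) (c : P.O q), M w = 1 →
      map e (mate (Sum.inr ⟨z, hyz.symm⟩) w (mate x y (mk L a) (mk K b)) (mk M c)) =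
      mate x (Sum.inl ⟨y, hyz⟩) (mk L a) (mate z w (mk K b) (mk M c)) by
    have h₁ : ∀ (m : ℕ) (L : A ≃ Fin (m + 2)) (a : P.O m), L x = 0 →
        ∀ (n : ℕ) (K : B ≃ Fin (n + 2)) (b : P.O n), K z = 0 ∧ K y = 1 → ∀ U : P.Spider C,
        map e (mate (Sum.inr ⟨z, hyz.symm⟩) w (mate x y (mk L a) (mk K b)) U) =
        mate x (Sum.inl ⟨y, hyz⟩) (mk L a) (mate z w (mk K b) U) :=
      fun m L a hL n K b hK => LinearMap.congr_fun (f := map e ∘ₗ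
          mate (Sum.inr ⟨z, hyz.symm⟩) w (mate x y (mk L a) (mk K b)))
        (g := mate x (Sum.inl (⟨y, hyz⟩ : {b // b ≠ z})) (mk L a) ∘ₗ mate z w (mk K b))
        (hom_ext_of_exists (fun q M => M w = 1) (fun q M => exists_relabel_one w M)
          (h m L a hL n K b hK))
    have h₂ : ∀ (m : ℕ) (L : A ≃ Fin (m + 2)) (a : P.O m), L x = 0 → ∀ T : P.Spider B,
        map e (mate (Sum.inr ⟨z, hyz.symm⟩) w (mate x y (mk L a) T) U) =
        mate x (Sum.inl ⟨y, hyz⟩) (mk L a) (mate z w T U) :=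
      fun m L a hL => LinearMap.congr_fun (f := map e ∘ₗ
          (mate (Sum.inr (⟨z, hyz.symm⟩ : {b // b ≠ y})) w).flip U ∘ₗ mate x y (mk L a))
        (g := mate x (Sum.inl (⟨y, hyz⟩ : {b // b ≠ z})) (mk L a) ∘ₗ (mate z w).flip U)
        (hom_ext_of_exists (fun n K => K z = 0 ∧ K y = 1)
          (fun n K => exists_relabel_zero_one z y hyz.symm K)
          fun n K b hK => h₁ m L a hL n K b hK U)
    exact LinearMap.congr_fun (f := map e ∘ₗ
          (mate (Sum.inr (⟨z, hyz.symm⟩ : {b // b ≠ y})) w).flip U ∘ₗ (mate x y).flip T)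
        (g := (mate x (Sum.inl (⟨y, hyz⟩ : {b // b ≠ z}))).flip (mate z w T U))
        (hom_ext_of_exists (fun m L => L x = 0) (fun m L => exists_relabel_zero x L)
          fun m L a hL => h₂ m L a hL T) S
  intro m L a hL n K b hK q M c hM
  -- The first input of `b` is still the first input after `b` is plugged into the first input of
  -- `c`, so sequential associativity applies with all indices `0`. Only the labelings remain to be
  -- compared.
  rw [mate_mk_of_eq x y rfl L K a b hL hK.2, mate_mk_of_eq z w rfl K M b c hK.1 hM,
    mate_mk_of_eq _ w (add_assoc q n m).symm _ M _ c (by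
      apply Fin.ext; rw [mateLabel_inr]; simp [hK.1]) hM,
    mate_mk_of_eq x _ rfl L _ a _ hL (by
      apply Fin.ext; rw [mateLabel_inl]; simp [hK.2]), map_mk,
    P.comp_seq rfl rfl rfl (add_assoc q n m).symm c b a 0 0 0 rfl]
  refine congrArg (fun f => mk f _) (Equiv.ext fun s => Fin.ext ?_)
  obtain ⟨s, rfl⟩ := e.surjective s
  rw [Equiv.trans_apply, Equiv.symm_apply_apply]
  rcases s with ⟨s | s, hs⟩ | s
  · rw [he₁, mateLabel_inl, mateLabel_inl, mateLabel_inl]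
  · have hs' : s.1 ≠ z := fun e0 => hs (congrArg Sum.inr (Subtype.ext e0))
    have hs'' : K s ≠ 0 := fun e0 => hs' (K.injective (e0.trans hK.1.symm))
    rw [he₂ _ _ hs', mateLabel_inl, mateLabel_inr, mateLabel_inr, if_neg hs'', if_neg]
    · simp [mateLabel_inl]
    · rw [Fin.ext_iff, mateLabel_inl]
      exact fun e0 => hs'' (Fin.ext e0)
  -- For a leg of `c`, the output label `0` is never shifted; any other label is shifted by `n + m`
  -- at once on one side, and by `n` and then `m` on the other.
  · rw [he₃, mateLabel_inr, mateLabel_inr]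
    have := mateLabel_inr rfl K M z w hK.1 hM s
    by_cases h0 : M s = 0
    · rw [if_pos h0] at this ⊢
      rw [if_pos (Fin.ext this)]
    · rw [if_neg h0] at this ⊢
      have h0' : (M s : ℕ) ≠ 0 := fun e => h0 (Fin.ext e)
      rw [if_neg, this]
      · omega
      · rw [Fin.ext_iff, this, Fin.val_zero]
        omega

/-- Symmetry of mating. -/
theorem mate_comm (lam : A) (mu : B) (S : P.Spider A) (T : P.Spider B) :
    map (Equiv.sumComm _ _) (mate lam mu S T) = mate mu lam T S := by
  have : ((mate lam mu).compr₂ (map (Equiv.sumComm _ _)) :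
      P.Spider A →ₗ[ℝ] P.Spider B →ₗ[ℝ] P.Spider _) = (mate mu lam).flip := by
    refine hom_ext_of_exists (fun m L => L lam = 0) (fun m L => exists_relabel_zero lam L)
      fun m L a hL => hom_ext_of_exists (fun n K => K mu = 1)
        (fun n K => exists_relabel_one mu K) fun n K b hK => ?_
    simp only [LinearMap.compr₂_apply, LinearMap.flip_apply]
    obtain ⟨k, h⟩ : ∃ k, n + m = k := ⟨_, rfl⟩
    have h' : m + n = k := by omega
    -- Writing `a` and `b` as rotations of `a₀` and `b₀` makes `rotate_comp` applicable: up to a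
    -- rotation, `b` composed with `a` is `a₀` composed with `b₀` at the last input. In these labels
    -- `lam` is the last input of `a₀` and `mu` the output of `b₀`, so the roles are exchanged as
    -- required.
    set r := finRotate (m + 2) with hr
    set r' := finRotate (n + 2) with hr'
    set R := finRotate (k + 2) with hR
    obtain ⟨a₀, rfl⟩ : ∃ a₀, P.act m r a₀ = a :=
      ⟨P.act m r⁻¹ a, by simp [← Module.End.mul_apply, ← map_mul]⟩
    obtain ⟨b₀, rfl⟩ : ∃ b₀, P.act n r' b₀ = b :=
      ⟨P.act n r'⁻¹ b, by simp [← Module.End.mul_apply, ← map_mul]⟩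
    -- The rotation leaves `lam` at the last input, whereas mating composes at the first one; `σ`
    -- moves it there and fixes the output.
    set σ : Equiv.Perm (Fin (m + 2)) := Equiv.swap (Fin.last (m + 1)) 1 with hσ
    set L₀ := L.trans r.symm with hL₀
    set K₀ := K.trans r'.symm with hK₀
    have hLr : ∀ x, L x = r (L₀ x) := fun x => by simp [hL₀]
    have hKr : ∀ x, K x = r' (K₀ x) := fun x => by simp [hK₀]
    have eL : (mk L (P.act m r a₀) : P.Spider A) = mk (L₀.trans σ) (P.act m σ a₀) := by
      rw [mk_act, ← mk_act L₀ r, hL₀, Equiv.trans_assoc, Equiv.symm_trans_self, Equiv.trans_refl]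
    have eK : (mk K (P.act n r' b₀) : P.Spider B) = mk K₀ b₀ := by
      rw [← mk_act K₀ r', hK₀, Equiv.trans_assoc, Equiv.symm_trans_self, Equiv.trans_refl]
    have hL1 : L₀ lam = Fin.last (m + 1) := by
      rw [hL₀, Equiv.trans_apply, Equiv.symm_apply_eq, hL, hr, Fin.ext_iff, rotate_val]; simp
    have hK1 : K₀ mu = 0 := by
      rw [hK₀, Equiv.trans_apply, Equiv.symm_apply_eq, hK, hr', Fin.ext_iff, rotate_val]; simp
    have hL2 : (L₀.trans σ) lam = 1 := by simp [hL1, hσ]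
    rw [mate_mk_of_eq lam mu h L K _ _ hL hK, eL, eK,
      mate_mk_of_eq mu lam h' K₀ (L₀.trans σ) _ _ hK1 hL2, ← P.rotate_comp h' h, map_mk]
    set e₁ := mateLabel h L K lam mu hL hK with he₁
    set e₂ := mateLabel h' K₀ (L₀.trans σ) mu lam hK1 hL2 with he₂
    set e₀ := ((Equiv.sumComm _ _).symm.trans e₁).trans R.symm with he₀
    have e01 : (Equiv.sumComm _ _).symm.trans e₁ = e₀.trans R := by ext; simp [he₀]
    rw [e01, mk_act, ← mk_act e₀ (e₀.symm.trans e₂)]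
    have e02 : e₀.trans (e₀.symm.trans e₂) = e₂ := by ext; simp
    rw [e02]
    have hrv : ∀ i, (r i : ℕ) = if (i : ℕ) = m + 1 then 0 else (i : ℕ) + 1 := rotate_val
    have hrv' : ∀ i, (r' i : ℕ) = if (i : ℕ) = n + 1 then 0 else (i : ℕ) + 1 := rotate_val
    have hRv : ∀ i, (R i : ℕ) = if (i : ℕ) = k + 1 then 0 else (i : ℕ) + 1 := rotate_val
    have hR0 : ∀ x, (R (e₀ x) : ℕ) = e₁ (x.swap) := fun x => by simp [he₀]
    congr 1
    -- The permutation `e₀.symm.trans e₂` compares the two labelings of the mated legs. Equivariance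
    -- applies once it is checked, leg by leg, to be the one induced by `σ`.
    have := P.comp_equivariant h' a₀ b₀ (Fin.last m) 0 σ 1 (e₀.symm.trans e₂) ?_ ?_ rfl ?_ ?_
    · rw [← this]; simp
    · exact Equiv.swap_apply_of_ne_of_ne (by simp [Fin.ext_iff]) (by simp)
    · simp [hσ]
    · intro s u hs hu
      have hs1 : (s : ℕ) ≠ m + 1 := fun e => hs (Fin.ext (by simpa using e))
      have hα : L₀.symm s ≠ lam := fun e => hs (by
        rw [Equiv.symm_apply_eq, hL1] at e; rw [e]; rfl)
      have hu' : u = e₀ (Sum.inr ⟨L₀.symm s, hα⟩) := by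
        have h0 := hR0 (Sum.inr ⟨L₀.symm s, hα⟩)
        rw [Sum.swap_inr, he₁, mateLabel_inl, hLr, hrv] at h0
        simp only [Equiv.apply_symm_apply] at h0
        rw [hRv, if_neg hs1] at h0
        apply Fin.ext
        rw [hu, Fin.val_last, if_pos (by omega)]
        split_ifs at h0
        omega
      rw [hu', Equiv.trans_apply, Equiv.symm_apply_apply, he₂, mateLabel_inr]
      simp only [Equiv.trans_apply, Equiv.apply_symm_apply, Fin.ext_iff, Fin.val_zero, Nat.le_zero]
      split_ifs <;> omega
    · intro t u ht hu
      have ht1 : (t : ℕ) ≠ 0 := fun e => ht (Fin.ext e)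
      have hβ : K₀.symm t ≠ mu := fun e => ht (by rw [Equiv.symm_apply_eq, hK1] at e; exact e)
      have hu' : u = e₀ (Sum.inl ⟨K₀.symm t, hβ⟩) := by
        have h0 := hR0 (Sum.inl ⟨K₀.symm t, hβ⟩)
        rw [Sum.swap_inl, he₁, mateLabel_inr] at h0
        simp only [hKr, Equiv.apply_symm_apply, Fin.ext_iff, hrv', hRv, Fin.val_zero] at h0
        apply Fin.ext
        rw [hu, Fin.val_last]
        have := t.2
        -- The last slot of `b₀` is the one that wraps around and is the output of `b`.
        by_cases h1 : (t : ℕ) = n + 1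
        · rw [if_pos h1, if_pos rfl] at h0
          split_ifs at h0
          omega
        · rw [if_neg h1, if_neg (Nat.succ_ne_zero _)] at h0
          split_ifs at h0 <;> omega
      rw [hu', Equiv.trans_apply, Equiv.symm_apply_apply, he₂, mateLabel_inl]
      simp
  exact LinearMap.congr_fun (LinearMap.congr_fun this S) T

/-- The rebracketing of the legs in `mate_assoc`. -/
def assocLegs (x : A) (y z : B) (w : C) (hyz : y ≠ z) :
    ({s : {a // a ≠ x} ⊕ {b // b ≠ y} // s ≠ Sum.inr ⟨z, hyz.symm⟩} ⊕ {c // c ≠ w}) ≃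
      ({a // a ≠ x} ⊕ {s : {b // b ≠ z} ⊕ {c // c ≠ w} // s ≠ Sum.inl ⟨y, hyz⟩}) where
  toFun
    | Sum.inl ⟨Sum.inl a, _⟩ => Sum.inl a
    | Sum.inl ⟨Sum.inr b, h⟩ => Sum.inr ⟨Sum.inl ⟨b.1, fun e => h (congrArg Sum.inr (Subtype.ext e))⟩,
        fun e => b.2 (congrArg Subtype.val (Sum.inl_injective e))⟩
    | Sum.inr c => Sum.inr ⟨Sum.inr c, Sum.inr_ne_inl⟩
  invFun
    | Sum.inl a => Sum.inl ⟨Sum.inl a, Sum.inl_ne_inr⟩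
    | Sum.inr ⟨Sum.inl b, h⟩ => Sum.inl ⟨Sum.inr ⟨b.1, fun e => h (congrArg Sum.inl (Subtype.ext e))⟩,
        fun e => b.2 (congrArg Subtype.val (Sum.inr_injective e))⟩
    | Sum.inr ⟨Sum.inr c, _⟩ => Sum.inr c
  left_inv := by rintro (⟨a | b, h⟩ | c) <;> rfl
  right_inv := by rintro (a | ⟨b | c, h⟩) <;> rfl

/-- Two spiders whose legs are labelled by elements of `H` agree if they correspond to each other under
a bijection of their legs that preserves the labels. -/
def Agree (ι : A → H) (S : P.Spider A) (κ : B → H) (T : P.Spider B) : Prop :=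
  ∃ e : A ≃ B, (∀ a, κ (e a) = ι a) ∧ map e S = T

/-- The labels of the legs of a mated spider. -/
def mateLegs (ι : A → H) (κ : B → H) (lam : A) (mu : B) :
    {a // a ≠ lam} ⊕ {b // b ≠ mu} → H :=
  Sum.elim (fun a => ι a) (fun b => κ b)

/-! ### Calculus of spiders with labelled legs -/

namespace Agree

variable {D : Type} {ι : A → H} {κ : B → H} {S : P.Spider A} {T : P.Spider B}

theorem refl (ι : A → H) (S : P.Spider A) : Agree ι S ι S :=
  ⟨Equiv.refl A, fun _ => rfl, map_id S⟩

theorem symm (h : Agree ι S κ T) : Agree κ T ι S := by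
  obtain ⟨e, he, rfl⟩ := h
  refine ⟨e.symm, fun b => ?_, ?_⟩
  · rw [← he, e.apply_symm_apply]
  · rw [map_map, Equiv.self_trans_symm, map_id]

theorem trans {ρ : C → H} {U : P.Spider C} (h : Agree ι S κ T) (h' : Agree κ T ρ U) :
    Agree ι S ρ U := by
  obtain ⟨e, he, rfl⟩ := h
  obtain ⟨f, hf, rfl⟩ := h'
  exact ⟨e.trans f, fun a => (hf _).trans (he a), (map_map e f S).symm⟩

theorem of_map (S : P.Spider A) (e : A ≃ B) (he : ∀ a, κ (e a) = ι a) : Agree ι S κ (map e S) :=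
  ⟨e, he, rfl⟩

theorem comp (h : Agree ι S κ T) (f : H → H') :
    Agree (fun a => f (ι a)) S (fun b => f (κ b)) T := by
  obtain ⟨e, he, rfl⟩ := h
  exact ⟨e, fun a => congrArg f (he a), rfl⟩

/-- Injective labels leave only one label-preserving bijection, so the unnamed witness of `Agree` is
whichever bijection a later construction supplies. -/
theorem map_eq (h : Agree ι S κ T) (hκ : Function.Injective κ) (e : A ≃ B)
    (he : ∀ a, κ (e a) = ι a) : map e S = T := by
  obtain ⟨f, hf, rfl⟩ := h
  rw [Equiv.ext fun a => hκ ((he a).trans (hf a).symm)]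

/-- Injectivity of the labels forces the two witnesses to carry the mated legs to each other, after
which naturality of mating (`mate_map`) applies. -/
theorem mate {ι' : C → H} {κ' : D → H} {S' : P.Spider C} {T' : P.Spider D}
    (h : Agree ι S κ T) (h' : Agree ι' S' κ' T') (hι : Function.Injective ι)
    (hι' : Function.Injective ι') (lam : A) (mu : C) (lam' : B) (mu' : D)
    (hlam : ι lam = κ lam') (hmu : ι' mu = κ' mu') :
    Agree (mateLegs ι ι' lam mu) (mate lam mu S S') (mateLegs κ κ' lam' mu')
      (Spider.mate lam' mu' T T') := by
  obtain ⟨e, he, rfl⟩ := h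
  obtain ⟨f, hf, rfl⟩ := h'
  have h1 : e lam = lam' := by
    rw [← Equiv.eq_symm_apply]
    exact hι (by rw [hlam, ← he, e.apply_symm_apply])
  have h2 : f mu = mu' := by
    rw [← Equiv.eq_symm_apply]
    exact hι' (by rw [hmu, ← hf, f.apply_symm_apply])
  rw [mate_map e f lam mu lam' mu' h1 h2]
  refine of_map _ _ ?_
  rintro (a | c)
  · exact he a
  · exact hf c

theorem mate_comm (ι : A → H) (κ : B → H) (S : P.Spider A) (T : P.Spider B) (lam : A) (mu : B) :
    Agree (mateLegs ι κ lam mu) (Spider.mate lam mu S T) (mateLegs κ ι mu lam)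
      (Spider.mate mu lam T S) := by
  rw [← Spider.mate_comm lam mu S T]
  refine of_map _ _ ?_
  rintro (a | b) <;> rfl

theorem mate_assoc (ι : A → H) (κ : B → H) (ρ : C → H) (S : P.Spider A) (T : P.Spider B)
    (U : P.Spider C) (x : A) (y z : B) (w : C) (hyz : y ≠ z) :
    Agree (mateLegs (mateLegs ι κ x y) ρ (Sum.inr ⟨z, hyz.symm⟩) w)
      (Spider.mate (Sum.inr ⟨z, hyz.symm⟩) w (Spider.mate x y S T) U)
      (mateLegs ι (mateLegs κ ρ z w) x (Sum.inl ⟨y, hyz⟩))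
      (Spider.mate x (Sum.inl ⟨y, hyz⟩) S (Spider.mate z w T U)) := by
  rw [← Spider.mate_assoc x y z w hyz S T U (assocLegs x y z w hyz) (fun _ _ => rfl)
    (fun _ _ _ => rfl) (fun _ => rfl)]
  refine of_map _ _ ?_
  rintro (⟨a | b, h⟩ | c) <;> rfl

end Agree

end CyclicOperad.Spider
end

/-! ### Collapsing an edge from either end, and the signs of deleting vertices -/

noncomputable section

variable {P : CyclicOperad.{u}} {k : ℕ}

namespace OGraph

open CyclicOperad.Spider (Agree mateLegs mate)

theorem color_agree (G : OGraph P k) {v w : Fin k} (h : v = w) :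
    Agree (Subtype.val : {h : G.H // G.vert h = v} → G.H) (G.color v)
      (Subtype.val : {h : G.H // G.vert h = w} → G.H) (G.color w) := by
  subst h
  exact Agree.refl _ _

/-- An isomorphism of `𝒪`-graphs from bijections under which the colors agree. -/
def Iso.ofAgree {H : Type} {G G' : OGraph P k} (σ : Equiv.Perm (Fin k)) (g : G.H ≃ G'.H)
    (vert_eq : ∀ h, G'.vert (g h) = σ (G.vert h)) (bar_eq : ∀ h, G'.bar (g h) = g (G.bar h))
    (ι : G.H → H) (ι' : G'.H → H) (hι' : Function.Injective ι') (hg : ∀ h, ι' (g h) = ι h)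
    (color_agree : ∀ v, Agree (fun h : {h : G.H // G.vert h = v} => ι h) (G.color v)
      (fun h : {h : G'.H // G'.vert h = σ v} => ι' h) (G'.color (σ v))) : Iso G G' where
  onVert := σ
  onHalf := g
  vert_eq := vert_eq
  bar_eq := bar_eq
  color_eq v := ((color_agree v).map_eq (hι'.comp Subtype.val_injective) _ fun h => hg h.1).symm

/-- Here and in the next lemma vertices of `G` are variables tied by equations. Colors at vertices
that are only propositionally equal can then be compared without transporting along those
equalities. -/
theorem collapse_agree_other (G : OGraph P (k + 1)) (x : G.H)
    (hx : G.vert x ≠ G.vert (G.bar x)) (t : Fin k) (v : Fin (k + 1))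
    (ht : (G.vert (G.bar x)).succAbove t = v) (hv : v ≠ G.vert x) :
    Agree (fun h : {h : (G.collapse x hx).H // (G.collapse x hx).vert h = t} => h.1.1)
      ((G.collapse x hx).color t) (Subtype.val : {h : G.H // G.vert h = v} → G.H) (G.color v) := by
  subst ht
  have : (G.collapse x hx).color t = CyclicOperad.Spider.map (G.otherLegs x hx t hv) _ :=
    dif_neg hv
  rw [this]
  exact (Agree.of_map _ _ fun _ => rfl).symm

theorem collapse_agree_merged (G : OGraph P (k + 1)) (x : G.H)
    (hx : G.vert x ≠ G.vert (G.bar x)) (t : Fin k) (v w : Fin (k + 1))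
    (ht : (G.vert (G.bar x)).succAbove t = G.vert x) (hv : G.vert x = v)
    (hw : G.vert (G.bar x) = w) :
    Agree (fun h : {h : (G.collapse x hx).H // (G.collapse x hx).vert h = t} => h.1.1)
      ((G.collapse x hx).color t)
      (mateLegs Subtype.val Subtype.val (⟨x, hv⟩ : {h // G.vert h = v})
        (⟨G.bar x, hw⟩ : {h // G.vert h = w}))
      (mate ⟨x, hv⟩ ⟨G.bar x, hw⟩ (G.color v) (G.color w)) := by
  subst hv hw
  have : (G.collapse x hx).color t = CyclicOperad.Spider.map (G.mergedLegs x hx t ht) _ :=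
    dif_pos ht
  rw [this]
  refine (Agree.of_map _ _ ?_).symm
  rintro (a | b) <;> rfl

theorem prod_dir_eq_one {G G' : OGraph P k} (f : Iso G G')
    (h : ∀ h, G'.dir (f.onHalf h) = G.dir h) :
    (∏ h : G.H, if G.dir h = 1 then G'.dir (f.onHalf h) else 1) = 1 := by
  refine Finset.prod_eq_one fun i _ => ?_
  rw [h]
  split_ifs with h1
  · exact h1
  · rfl

/-- Collapsing an edge from either of its halves gives isomorphic `𝒪`-graphs. -/
def collapseBarIso (G : OGraph P (k + 1)) (x : G.H) (hx : G.vert x ≠ G.vert (G.bar x))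
    (hx' : G.vert (G.bar x) ≠ G.vert (G.bar (G.bar x))) :
    Iso (G.collapse x hx) (G.collapse (G.bar x) hx') :=
  have hb : G.vert (G.bar (G.bar x)) = G.vert x := congrArg G.vert (G.bar_bar x)
  -- The two collapses keep the merged vertex at different places. Exchanging the two ends carries
  -- the deleted vertex of one to that of the other, and the permutation induced on the rest matches
  -- the numberings.
  have hσ : Equiv.swap (G.vert x) (G.vert (G.bar x)) (G.vert (G.bar x)) =
      G.vert (G.bar (G.bar x)) := by rw [Equiv.swap_apply_right, hb]
  Iso.ofAgree (restrictPerm (Equiv.swap (G.vert x) (G.vert (G.bar x))) _ _ hσ)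
    (Equiv.subtypeEquivRight fun h => by rw [G.bar_bar, and_comm])
    (fun h => by
      change mergeVert _ _ hx' (G.vert h.1) = restrictPerm _ _ _ hσ (mergeVert _ _ hx (G.vert h.1))
      rw [mergeVert_eq_iff, succAbove_restrictPerm, succAbove_mergeVert, hb, Equiv.swap_apply_def]
      split_ifs <;> simp_all)
    (fun _ => rfl) Subtype.val Subtype.val Subtype.val_injective (fun _ => rfl)
    (fun t => by
      have hs := succAbove_restrictPerm _ _ _ hσ t
      by_cases ht : (G.vert (G.bar x)).succAbove t = G.vert x
      · rw [ht, Equiv.swap_apply_left] at hs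
        refine (G.collapse_agree_merged x hx t _ _ ht rfl rfl).trans
          (Agree.trans ?_ (G.collapse_agree_merged (G.bar x) hx' _ _ _ hs rfl hb).symm)
        have := Agree.mate_comm (Subtype.val : {h // G.vert h = G.vert x} → G.H)
          (Subtype.val : {h // G.vert h = G.vert (G.bar x)} → G.H) (G.color (G.vert x))
          (G.color (G.vert (G.bar x))) ⟨x, rfl⟩ ⟨G.bar x, rfl⟩
        have hx2 : (⟨G.bar (G.bar x), hb⟩ : {h // G.vert h = G.vert x}) = ⟨x, rfl⟩ :=
          Subtype.ext (G.bar_bar x)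
        rw [hx2]
        exact this
      · rw [Equiv.swap_apply_of_ne_of_ne ht (Fin.succAbove_ne _ _)] at hs
        exact (G.collapse_agree_other x hx t _ rfl ht).trans
          (G.collapse_agree_other (G.bar x) hx' _ _ hs (Fin.succAbove_ne _ _)).symm)

/-- The `-1` of the transposition of the two ends is absorbed by the opposite directions of the two
halves of the edge. -/
theorem collapseBarIso_sign (G : OGraph P (k + 1)) (x : G.H)
    (hx : G.vert x ≠ G.vert (G.bar x)) (hx' : G.vert (G.bar x) ≠ G.vert (G.bar (G.bar x))) :
    (G.collapseBarIso x hx hx').sign =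
      ((-1) ^ (G.vert (G.bar x) : ℕ) * G.dir (G.bar x)) *
      ((-1) ^ (G.vert (G.bar (G.bar x)) : ℕ) * G.dir (G.bar (G.bar x))) := by
  have hσ : Equiv.swap (G.vert x) (G.vert (G.bar x)) (G.vert (G.bar x)) =
      G.vert (G.bar (G.bar x)) := by rw [Equiv.swap_apply_right, G.bar_bar]
  have h1 := sign_restrictPerm _ _ _ hσ
  rw [Equiv.Perm.sign_swap hx] at h1
  have h2 : (G.collapseBarIso x hx hx').sign = Equiv.Perm.sign (restrictPerm _ _ _ hσ) * _ := rfl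
  rw [h2, prod_dir_eq_one (G.collapseBarIso x hx hx') fun _ => rfl, G.dir_bar (G.bar x), mul_one]
  have h3 : ∀ s t r d : ℤˣ, -1 = s * t * r → r = s * d * (t * -d) := by decide
  exact h3 _ _ _ _ h1

/-- The term thus depends on the edge alone, which gives the freedom to choose a half of each edge
in the proof of anticommutation. -/
theorem collapseTerm_bar (G : OGraph P (k + 1)) (x : G.H) :
    G.collapseTerm (G.bar x) = G.collapseTerm x := by
  by_cases hx : G.vert x ≠ G.vert (G.bar x)
  · have hx' : G.vert (G.bar x) ≠ G.vert (G.bar (G.bar x)) := by rw [G.bar_bar]; exact hx.symm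
    rw [collapseTerm, collapseTerm, dif_pos hx, dif_pos hx', toChain_iso (G.collapseBarIso x hx hx'),
      smul_smul, collapseBarIso_sign]
    congr 1
    generalize (-1) ^ (G.vert (G.bar x) : ℕ) * G.dir (G.bar x) = s
    generalize (-1) ^ (G.vert (G.bar (G.bar x)) : ℕ) * G.dir (G.bar (G.bar x)) = s'
    rcases Int.units_eq_one_or s with h | h <;> rcases Int.units_eq_one_or s' with h' | h' <;>
      simp [h, h']
  · have hx' : ¬ G.vert (G.bar x) ≠ G.vert (G.bar (G.bar x)) := by
      rwa [G.bar_bar, ne_comm]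
    rw [collapseTerm, collapseTerm, dif_neg hx, dif_neg hx']

theorem mergeVert_eq_mergeVert_iff (v w : Fin (k + 1)) (h : v ≠ w) (u u' : Fin (k + 1)) :
    mergeVert v w h u = mergeVert v w h u' ↔
      (if u = w then v else u) = if u' = w then v else u' := by
  rw [mergeVert_eq_iff, succAbove_mergeVert]

/-- Here `d'` is the position of `d` after `b` is deleted, and `b'` that of `b` after `d` is
deleted. Both composites enumerate the complement of `{b, d}` in increasing order. -/
theorem succAbove_succAbove_comm {b d : Fin (k + 2)} {b' d' : Fin (k + 1)} (h : b.succAbove d' = d)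
    (h' : d.succAbove b' = b) (t : Fin k) :
    b.succAbove (d'.succAbove t) = d.succAbove (b'.succAbove t) := by
  subst h
  simp only [Fin.succAbove, Fin.lt_def, Fin.ext_iff] at *
  split_ifs at * <;> simp_all <;> omega

/-- The larger of `b` and `d` drops by one when the smaller is deleted first, and the smaller is
never shifted, so the exponents differ by exactly one. This is the source of the anticommutation. -/
theorem neg_one_pow_succAbove {b d : Fin (k + 2)} {b' d' : Fin (k + 1)} (h : b.succAbove d' = d)
    (h' : d.succAbove b' = b) :
    (-1 : ℤˣ) ^ (b : ℕ) * (-1) ^ (d' : ℕ) = - ((-1) ^ (d : ℕ) * (-1) ^ (b' : ℕ)) := by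
  rw [← pow_add, ← pow_add]
  have : (b + d' : ℕ) + 1 = d + b' ∨ (d + b' : ℕ) + 1 = b + d' := by
    subst h
    simp only [Fin.succAbove, Fin.lt_def, Fin.ext_iff] at *
    split_ifs at * <;> simp_all <;> omega
  rcases this with h | h <;> rw [← h, pow_succ] <;> simp

/-- A half-edge that is not on the collapsed edge, as a half-edge of the collapsed graph. -/
def collapseHalf (G : OGraph P (k + 1)) (x : G.H) (hx : G.vert x ≠ G.vert (G.bar x)) (z : G.H)
    (hz : z ≠ x ∧ z ≠ G.bar x) : (G.collapse x hx).H :=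
  ⟨z, hz⟩

section doubleCollapse

variable (G : OGraph P (k + 2)) (x z : G.H)

/-- The collapse of the edge of `x` followed by the collapse of the edge of `z`, with signs. -/
def doubleCollapse : ChainGroup P k :=
  if h : G.vert x ≠ G.vert (G.bar x) ∧ z ≠ x ∧ z ≠ G.bar x then
    ((((-1) ^ (G.vert (G.bar x) : ℕ) * G.dir (G.bar x) : ℤˣ) : ℤ) : ℝ) •
      (G.collapse x h.1).collapseTerm (G.collapseHalf x h.1 z h.2)
  else 0

theorem doubleCollapse_iso {G G' : OGraph P (k + 2)} (f : Iso G G') (x z : G.H) :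
    G.doubleCollapse x z = ((f.sign : ℤ) : ℝ) • G'.doubleCollapse (f.onHalf x) (f.onHalf z) := by
  have hw : f.onVert (G.vert (G.bar x)) = G'.vert (G'.bar (f.onHalf x)) := by
    rw [f.bar_eq, f.vert_eq]
  have iff : (G.vert x ≠ G.vert (G.bar x) ∧ z ≠ x ∧ z ≠ G.bar x) ↔
      (G'.vert (f.onHalf x) ≠ G'.vert (G'.bar (f.onHalf x)) ∧ f.onHalf z ≠ f.onHalf x ∧
        f.onHalf z ≠ G'.bar (f.onHalf x)) := by
    rw [← hw, f.vert_eq, f.bar_eq, Ne, Ne, Ne, Ne, Ne, Ne, f.onVert.injective.eq_iff,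
      f.onHalf.injective.eq_iff, f.onHalf.injective.eq_iff]
  by_cases h : G.vert x ≠ G.vert (G.bar x) ∧ z ≠ x ∧ z ≠ G.bar x
  · have h' := iff.1 h
    rw [doubleCollapse, doubleCollapse, dif_pos h, dif_pos h',
      collapseTerm_iso (collapseIso f h.1 h'.1 hw), smul_smul, smul_smul,
      collapseIso_sign f h.1 h'.1 hw]
    refine congrArg₂ (· • ·) ?_ rfl
    generalize (-1) ^ (G.vert (G.bar x) : ℕ) * G.dir (G.bar x) = s
    generalize (-1) ^ (G'.vert (G'.bar (f.onHalf x)) : ℕ) * G'.dir (G'.bar (f.onHalf x)) = s'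
    rcases Int.units_eq_one_or s with h | h <;> rcases Int.units_eq_one_or s' with h' | h' <;>
      simp [h, h']
  · rw [doubleCollapse, doubleCollapse, dif_neg h, dif_neg (mt iff.2 h), smul_zero]

theorem doubleCollapse_bar_right : G.doubleCollapse x (G.bar z) = G.doubleCollapse x z := by
  have iff : (G.bar z ≠ x ∧ G.bar z ≠ G.bar x) ↔ (z ≠ x ∧ z ≠ G.bar x) := by
    have h1 : G.bar z = x ↔ z = G.bar x :=
      ⟨fun e => by rw [← e, G.bar_bar], fun e => by rw [e, G.bar_bar]⟩
    have h2 : G.bar z = G.bar x ↔ z = x :=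
      ⟨fun e => by rw [← G.bar_bar z, e, G.bar_bar], fun e => by rw [e]⟩
    rw [Ne, Ne, h1, h2, and_comm]
  by_cases h : G.vert x ≠ G.vert (G.bar x) ∧ z ≠ x ∧ z ≠ G.bar x
  · rw [doubleCollapse, doubleCollapse, dif_pos h, dif_pos ⟨h.1, iff.2 h.2⟩]
    exact congrArg _ ((G.collapse x h.1).collapseTerm_bar (G.collapseHalf x h.1 z h.2))
  · rw [doubleCollapse, doubleCollapse, dif_neg h, dif_neg fun h' => h ⟨h'.1, iff.1 h'.2⟩]

theorem doubleCollapse_bar_left : G.doubleCollapse (G.bar x) z = G.doubleCollapse x z := by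
  by_cases h : G.vert x ≠ G.vert (G.bar x) ∧ z ≠ x ∧ z ≠ G.bar x
  · have h' : G.vert (G.bar x) ≠ G.vert (G.bar (G.bar x)) ∧ z ≠ G.bar x ∧ z ≠ G.bar (G.bar x) := by
      rw [G.bar_bar]; exact ⟨h.1.symm, h.2.2, h.2.1⟩
    rw [doubleCollapse, doubleCollapse, dif_pos h, dif_pos h',
      collapseTerm_iso (G.collapseBarIso x h.1 h'.1) (G.collapseHalf x h.1 z h.2), smul_smul,
      collapseBarIso_sign]
    refine congrArg₂ (· • ·) ?_ rfl
    generalize (-1) ^ (G.vert (G.bar x) : ℕ) * G.dir (G.bar x) = s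
    generalize (-1) ^ (G.vert (G.bar (G.bar x)) : ℕ) * G.dir (G.bar (G.bar x)) = s'
    rcases Int.units_eq_one_or s with h | h <;> rcases Int.units_eq_one_or s' with h' | h' <;>
      simp [h, h']
  · rw [doubleCollapse, doubleCollapse, dif_neg h, dif_neg]
    rw [G.bar_bar]
    exact fun h' => h ⟨h'.1.symm, h'.2.2, h'.2.1⟩

/-- The hypothesis says that `z` has become a loop once `vert (bar x)` is merged into `vert x`. -/
theorem doubleCollapse_eq_zero (h : (if G.vert z = G.vert (G.bar x) then G.vert x else G.vert z) =
    if G.vert (G.bar z) = G.vert (G.bar x) then G.vert x else G.vert (G.bar z)) :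
    G.doubleCollapse x z = 0 := by
  rw [doubleCollapse]
  split_ifs with hx
  · have := (mergeVert_eq_mergeVert_iff _ _ hx.1 _ _).2 h
    have h0 : (G.collapse x hx.1).collapseTerm (G.collapseHalf x hx.1 z hx.2) = 0 :=
      dif_neg (not_not.2 this)
    rw [h0, smul_zero]
  · rfl

end doubleCollapse

end OGraph
end

/-! ### Anticommutation of two collapses -/

noncomputable section

variable {P : CyclicOperad.{u}} {k : ℕ}

namespace OGraph

open CyclicOperad.Spider (Agree mateLegs mate)

theorem collapse_agree_merged_comp {H : Type} (G : OGraph P (k + 1)) (f : G.H → H) (x : G.H)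
    (hx : G.vert x ≠ G.vert (G.bar x)) (t : Fin k) (v w : Fin (k + 1))
    (ht : (G.vert (G.bar x)).succAbove t = G.vert x) (hv : G.vert x = v)
    (hw : G.vert (G.bar x) = w) :
    Agree (fun h : {h : (G.collapse x hx).H // (G.collapse x hx).vert h = t} => f h.1.1)
      ((G.collapse x hx).color t)
      (mateLegs (fun h => f h.1) (fun h => f h.1) (⟨x, hv⟩ : {h // G.vert h = v})
        (⟨G.bar x, hw⟩ : {h // G.vert h = w}))
      (mate ⟨x, hv⟩ ⟨G.bar x, hw⟩ (G.color v) (G.color w)) := by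
  have := (G.collapse_agree_merged x hx t v w ht hv hw).comp f
  convert this using 2 with s
  rcases s with s | s <;> rfl

theorem collapse_leg_injective (G : OGraph P (k + 1)) (x : G.H)
    (hx : G.vert x ≠ G.vert (G.bar x)) (t : Fin k) : Function.Injective
      (fun h : {h : (G.collapse x hx).H // (G.collapse x hx).vert h = t} => h.1.1) :=
  Subtype.val_injective.comp Subtype.val_injective

section comm

variable (G : OGraph P (k + 2)) (x z : G.H) (hx : G.vert x ≠ G.vert (G.bar x))
  (hz : G.vert z ≠ G.vert (G.bar z)) (hzx : z ≠ x ∧ z ≠ G.bar x) (hxz : x ≠ z ∧ x ≠ G.bar z)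

theorem succAbove_vert_collapseHalf :
    (G.vert (G.bar x)).succAbove ((G.collapse x hx).vert (G.collapseHalf x hx z hzx)) =
      if G.vert z = G.vert (G.bar x) then G.vert x else G.vert z :=
  succAbove_mergeVert ..

theorem succAbove_vert_bar_collapseHalf :
    (G.vert (G.bar x)).succAbove
      ((G.collapse x hx).vert ((G.collapse x hx).bar (G.collapseHalf x hx z hzx))) =
      if G.vert (G.bar z) = G.vert (G.bar x) then G.vert x else G.vert (G.bar z) :=
  succAbove_mergeVert ..

variable (h₁ : (G.collapse x hx).vert (G.collapseHalf x hx z hzx) ≠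
    (G.collapse x hx).vert ((G.collapse x hx).bar (G.collapseHalf x hx z hzx)))
  (h₂ : (G.collapse z hz).vert (G.collapseHalf z hz x hxz) ≠
    (G.collapse z hz).vert ((G.collapse z hz).bar (G.collapseHalf z hz x hxz)))

/-- The half-edges that remain after the collapse of two edges. -/
def collapseCommHalf : ((G.collapse x hx).collapse (G.collapseHalf x hx z hzx) h₁).H ≃
    ((G.collapse z hz).collapse (G.collapseHalf z hz x hxz) h₂).H where
  toFun h := ⟨⟨h.1.1, fun e => h.2.1 (Subtype.ext e), fun e => h.2.2 (Subtype.ext e)⟩,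
    fun e => h.1.2.1 (congrArg Subtype.val e), fun e => h.1.2.2 (congrArg Subtype.val e)⟩
  invFun h := ⟨⟨h.1.1, fun e => h.2.1 (Subtype.ext e), fun e => h.2.2 (Subtype.ext e)⟩,
    fun e => h.1.2.1 (congrArg Subtype.val e), fun e => h.1.2.2 (congrArg Subtype.val e)⟩
  left_inv _ := rfl
  right_inv _ := rfl

/-- When the vertices at `bar x` and `bar z` differ, both orders delete exactly these two. The
surviving vertices get the same numbers, and the comparison isomorphism can be the identity on
vertices. -/
theorem succAbove_collapse_comm (hdb : G.vert (G.bar z) ≠ G.vert (G.bar x)) (t : Fin k) :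
    (G.vert (G.bar x)).succAbove
      (((G.collapse x hx).vert ((G.collapse x hx).bar (G.collapseHalf x hx z hzx))).succAbove t) =
    (G.vert (G.bar z)).succAbove
      (((G.collapse z hz).vert ((G.collapse z hz).bar (G.collapseHalf z hz x hxz))).succAbove t) := by
  refine succAbove_succAbove_comm ?_ ?_ t
  · rw [succAbove_vert_bar_collapseHalf, if_neg hdb]
  · rw [succAbove_vert_bar_collapseHalf, if_neg hdb.symm]

theorem collapse_comm_vert (hcb : G.vert z ≠ G.vert (G.bar x))
    (hdb : G.vert (G.bar z) ≠ G.vert (G.bar x)) (h) :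
    ((G.collapse z hz).collapse (G.collapseHalf z hz x hxz) h₂).vert
        (G.collapseCommHalf x z hx hz hzx hxz h₁ h₂ h) =
      ((G.collapse x hx).collapse (G.collapseHalf x hx z hzx) h₁).vert h := by
  obtain ⟨⟨h, h3⟩, h4⟩ := h
  refine (mergeVert_eq_iff _ _ h₂ _ _).2 ?_
  -- Vertices of the doubly collapsed graphs are compared through their original numbers in `G`.
  apply (G.vert (G.bar z)).succAbove_right_injective
  rw [← succAbove_collapse_comm G x z hx hz hzx hxz hdb]
  have e1 := succAbove_mergeVert _ _ h₁ (mergeVert _ _ hx (G.vert h))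
  refine Eq.trans ?_ (congrArg (G.vert (G.bar x)).succAbove e1).symm
  rw [apply_ite (G.vert (G.bar x)).succAbove, apply_ite (G.vert (G.bar z)).succAbove,
    succAbove_vert_collapseHalf, succAbove_vert_collapseHalf]
  have e2 : (G.vert (G.bar x)).succAbove (mergeVert _ _ hx (G.vert h)) = _ :=
    succAbove_mergeVert ..
  have e3 : (G.vert (G.bar z)).succAbove (mergeVert _ _ hz (G.vert h)) = _ :=
    succAbove_mergeVert ..
  have e4 : mergeVert _ _ hx (G.vert h) = (G.collapse x hx).vert ((G.collapse x hx).bar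
      (G.collapseHalf x hx z hzx)) ↔ _ := mergeVert_eq_mergeVert_iff _ _ hx (G.vert h)
        (G.vert (G.bar z))
  have e5 : mergeVert _ _ hz (G.vert h) = (G.collapse z hz).vert ((G.collapse z hz).bar
      (G.collapseHalf z hz x hxz)) ↔ _ := mergeVert_eq_mergeVert_iff _ _ hz (G.vert h)
        (G.vert (G.bar x))
  rw [e2]
  change (if mergeVert _ _ hz (G.vert h) = _ then _ else
    (G.vert (G.bar z)).succAbove (mergeVert _ _ hz (G.vert h))) = _
  rw [e3]
  simp only [e4, e5, if_neg hcb, if_neg hdb, if_neg hdb.symm]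
  grind

/-- The hypotheses allow the two edges to share an endpoint only as `vert x = vert (bar z)`. Then
three spiders in a row are mated and associativity is needed; otherwise the two matings do not
interact. The cases below are distinguished by the vertex of `G` numbered `t` in the end. -/
theorem collapse_comm_agree (hcb : G.vert z ≠ G.vert (G.bar x))
    (hdb : G.vert (G.bar z) ≠ G.vert (G.bar x)) (hac : G.vert x ≠ G.vert z) (t : Fin k) :
    Agree (fun h : {h // ((G.collapse x hx).collapse (G.collapseHalf x hx z hzx) h₁).vert h = t} =>
        h.1.1.1)
      (((G.collapse x hx).collapse (G.collapseHalf x hx z hzx) h₁).color t)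
      (fun h : {h // ((G.collapse z hz).collapse (G.collapseHalf z hz x hxz) h₂).vert h = t} =>
        h.1.1.1)
      (((G.collapse z hz).collapse (G.collapseHalf z hz x hxz) h₂).color t) := by
  have hs := succAbove_collapse_comm G x z hx hz hzx hxz hdb t
  have c₁ := G.succAbove_vert_collapseHalf x z hx hzx
  have d₁ := G.succAbove_vert_bar_collapseHalf x z hx hzx
  have a₂ := G.succAbove_vert_collapseHalf z x hz hxz
  have b₂ := G.succAbove_vert_bar_collapseHalf z x hz hxz
  rw [if_neg hcb] at c₁
  rw [if_neg hdb] at d₁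
  rw [if_neg hdb.symm] at b₂
  set G₁ := G.collapse x hx with hG₁
  set G₂ := G.collapse z hz with hG₂
  set z₁ := G.collapseHalf x hx z hzx with hz₁
  set x₂ := G.collapseHalf z hz x hxz with hx₂
  obtain ⟨s₁, hs₁⟩ : ∃ s, (G₁.vert (G₁.bar z₁)).succAbove t = s := ⟨_, rfl⟩
  obtain ⟨s₂, hs₂⟩ : ∃ s, (G₂.vert (G₂.bar x₂)).succAbove t = s := ⟨_, rfl⟩
  rw [hs₁, hs₂] at hs
  have hrb := Fin.succAbove_ne (G.vert (G.bar x)) s₁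
  have hrd := Fin.succAbove_ne (G.vert (G.bar z)) s₂
  have i₁ : s₁ = G₁.vert z₁ ↔ (G.vert (G.bar x)).succAbove s₁ = G.vert z := by
    rw [← c₁, Fin.succAbove_right_inj]
  have i₂ : s₂ = G₂.vert x₂ ↔ (G.vert (G.bar x)).succAbove s₁ =
      if G.vert x = G.vert (G.bar z) then G.vert z else G.vert x := by
    rw [← a₂, hs, Fin.succAbove_right_inj]
  by_cases hr : (G.vert (G.bar x)).succAbove s₁ = G.vert z
  · have A₁ := G₁.collapse_agree_merged_comp (Subtype.val : G₁.H → G.H) z₁ h₁ t _ _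
      (hs₁.trans (i₁.2 hr)) rfl rfl
    have C := G.collapse_agree_other x hx _ _ c₁ hac.symm
    -- If this holds, the edges form a path from `vert z` through `vert x` to `vert (bar x)`, and
    -- the two orders of collapse are the two bracketings of the three spiders along it.
    by_cases had : G.vert x = G.vert (G.bar z)
    · rw [if_pos had] at i₂ a₂
      have D := G.collapse_agree_merged x hx _ _ _ (d₁.trans had.symm) had rfl
      have B₁ := G₂.collapse_agree_merged_comp (Subtype.val : G₂.H → G.H) x₂ h₂ t _ _
        (hs₂.trans (i₂.2 hr)) rfl rfl
      have A₂ := G.collapse_agree_merged z hz _ _ _ a₂ rfl rfl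
      have B₂ := G.collapse_agree_other z hz _ _ b₂ hcb.symm
      have hne : (⟨G.bar z, rfl⟩ : {h // G.vert h = G.vert (G.bar z)}) ≠ ⟨x, had⟩ :=
        fun e => hxz.2 (congrArg Subtype.val e).symm
      have E₁ := C.mate D (G.collapse_leg_injective x hx _) (G.collapse_leg_injective x hx _)
        ⟨z₁, rfl⟩ ⟨G₁.bar z₁, rfl⟩ ⟨z, rfl⟩ (Sum.inl ⟨⟨G.bar z, rfl⟩, hne⟩) rfl rfl
      have E₂ := A₂.mate B₂ (G.collapse_leg_injective z hz _) (G.collapse_leg_injective z hz _)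
        ⟨x₂, rfl⟩ ⟨G₂.bar x₂, rfl⟩ (Sum.inr ⟨⟨x, had⟩, hne.symm⟩) ⟨G.bar x, rfl⟩ rfl rfl
      exact (A₁.trans E₁).trans
        ((Agree.mate_assoc _ _ _ _ _ _ _ _ _ _ hne).symm.trans (B₁.trans E₂).symm)
    · rw [if_neg had] at i₂
      have D := G.collapse_agree_other x hx _ _ d₁ (Ne.symm had)
      have E := C.mate D (G.collapse_leg_injective x hx _) (G.collapse_leg_injective x hx _)
        ⟨z₁, rfl⟩ ⟨G₁.bar z₁, rfl⟩ ⟨z, rfl⟩ ⟨G.bar z, rfl⟩ rfl rfl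
      have B₁ := (G₂.collapse_agree_other x₂ h₂ t s₂ hs₂
        (mt i₂.1 (by rw [hr]; exact hac.symm))).comp (Subtype.val : G₂.H → G.H)
      have B₂ := G.collapse_agree_merged z hz s₂ _ _ (hs.symm.trans hr) rfl rfl
      exact (A₁.trans E).trans (B₁.trans B₂).symm
  · have A₁ := (G₁.collapse_agree_other z₁ h₁ t s₁ hs₁ (mt i₁.1 hr)).comp
      (Subtype.val : G₁.H → G.H)
    -- Here `vert x` survives, so it is not the deleted vertex `vert (bar z)`: only the edge of `x`
    -- affects its color.
    by_cases hr' : (G.vert (G.bar x)).succAbove s₁ = G.vert x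
    · have had : G.vert x ≠ G.vert (G.bar z) := by rw [← hr', hs]; exact hrd
      rw [if_neg had] at i₂ a₂
      have A₂ := G.collapse_agree_merged x hx s₁ _ _ hr' rfl rfl
      have B₁ := G₂.collapse_agree_merged_comp (Subtype.val : G₂.H → G.H) x₂ h₂ t _ _
        (hs₂.trans (i₂.2 hr')) rfl rfl
      have C := G.collapse_agree_other z hz _ _ a₂ hac
      have D := G.collapse_agree_other z hz _ _ b₂ hcb.symm
      have E := C.mate D (G.collapse_leg_injective z hz _) (G.collapse_leg_injective z hz _)
        ⟨x₂, rfl⟩ ⟨G₂.bar x₂, rfl⟩ ⟨x, rfl⟩ ⟨G.bar x, rfl⟩ rfl rfl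
      exact (A₁.trans A₂).trans (B₁.trans E).symm
    · have A₂ := G.collapse_agree_other x hx s₁ _ rfl hr'
      have B₁ := (G₂.collapse_agree_other x₂ h₂ t s₂ hs₂ (mt i₂.1 (by split_ifs <;> assumption))).comp
        (Subtype.val : G₂.H → G.H)
      have B₂ := G.collapse_agree_other z hz s₂ _ hs.symm hr
      exact (A₁.trans A₂).trans (B₁.trans B₂).symm

/-- Collapsing two edges in either order gives isomorphic `𝒪`-graphs. -/
def collapseCommIso (hcb : G.vert z ≠ G.vert (G.bar x))
    (hdb : G.vert (G.bar z) ≠ G.vert (G.bar x)) (hac : G.vert x ≠ G.vert z) :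
    Iso ((G.collapse x hx).collapse (G.collapseHalf x hx z hzx) h₁)
      ((G.collapse z hz).collapse (G.collapseHalf z hz x hxz) h₂) :=
  Iso.ofAgree 1 (G.collapseCommHalf x z hx hz hzx hxz h₁ h₂)
    (G.collapse_comm_vert x z hx hz hzx hxz h₁ h₂ hcb hdb) (fun _ => rfl)
    (fun h => h.1.1) (fun h => h.1.1) (Subtype.val_injective.comp Subtype.val_injective)
    (fun _ => rfl) (G.collapse_comm_agree x z hx hz hzx hxz h₁ h₂ hcb hdb hac)

theorem collapseCommIso_sign (hcb : G.vert z ≠ G.vert (G.bar x))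
    (hdb : G.vert (G.bar z) ≠ G.vert (G.bar x)) (hac : G.vert x ≠ G.vert z) :
    (G.collapseCommIso x z hx hz hzx hxz h₁ h₂ hcb hdb hac).sign = 1 := by
  have h := prod_dir_eq_one (G.collapseCommIso x z hx hz hzx hxz h₁ h₂ hcb hdb hac) fun _ => rfl
  rw [Iso.sign, h, mul_one]
  exact Equiv.Perm.sign_one

end comm

theorem smul_units_smul {M : Type*} [AddCommGroup M] [Module ℝ M] (s t : ℤˣ) (m : M) :
    ((s : ℤ) : ℝ) • ((t : ℤ) : ℝ) • m = (((s * t : ℤˣ) : ℤ) : ℝ) • m := by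
  rw [smul_smul]; push_cast; rfl

theorem neg_units_smul {M : Type*} [AddCommGroup M] [Module ℝ M] (s : ℤˣ) (m : M) :
    (((-s : ℤˣ) : ℤ) : ℝ) • m = -(((s : ℤ) : ℝ) • m) := by
  push_cast; rw [neg_smul]

theorem doubleCollapse_comm_of_ne (G : OGraph P (k + 2)) (x z : G.H)
    (hzx : z ≠ x ∧ z ≠ G.bar x)
    (hx : G.vert x ≠ G.vert (G.bar x)) (hz : G.vert z ≠ G.vert (G.bar z))
    (hcb : G.vert z ≠ G.vert (G.bar x)) (hdb : G.vert (G.bar z) ≠ G.vert (G.bar x))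
    (hac : G.vert x ≠ G.vert z) :
    G.doubleCollapse x z = -G.doubleCollapse z x := by
  have hxz : x ≠ z ∧ x ≠ G.bar z := ⟨hzx.1.symm, fun e => hzx.2 (by rw [e, G.bar_bar])⟩
  have h₁ : (G.collapse x hx).vert (G.collapseHalf x hx z hzx) ≠
      (G.collapse x hx).vert ((G.collapse x hx).bar (G.collapseHalf x hx z hzx)) := fun e => by
    have := (mergeVert_eq_mergeVert_iff _ _ hx (G.vert z) (G.vert (G.bar z))).1 e
    rw [if_neg hcb, if_neg hdb] at this
    exact hz this
  have h₂ : (G.collapse z hz).vert (G.collapseHalf z hz x hxz) ≠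
      (G.collapse z hz).vert ((G.collapse z hz).bar (G.collapseHalf z hz x hxz)) := fun e => by
    have := (mergeVert_eq_mergeVert_iff _ _ hz (G.vert x) (G.vert (G.bar x))).1 e
    rw [if_neg hdb.symm] at this
    split_ifs at this
    · exact hcb this
    · exact hx this
  have e₁ : G.doubleCollapse x z = ((((-1) ^ (G.vert (G.bar x) : ℕ) * G.dir (G.bar x) : ℤˣ) : ℤ) : ℝ) •
      ((((-1) ^ ((G.collapse x hx).vert ((G.collapse x hx).bar (G.collapseHalf x hx z hzx)) : ℕ) *
        G.dir (G.bar z) : ℤˣ) : ℤ) : ℝ) • (OGraph.collapse _ _ h₁).toChain :=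
    (dif_pos ⟨hx, hzx⟩).trans (congrArg _ (dif_pos h₁))
  have e₂ : G.doubleCollapse z x = ((((-1) ^ (G.vert (G.bar z) : ℕ) * G.dir (G.bar z) : ℤˣ) : ℤ) : ℝ) •
      ((((-1) ^ ((G.collapse z hz).vert ((G.collapse z hz).bar (G.collapseHalf z hz x hxz)) : ℕ) *
        G.dir (G.bar x) : ℤˣ) : ℤ) : ℝ) • (OGraph.collapse _ _ h₂).toChain :=
    (dif_pos ⟨hz, hxz⟩).trans (congrArg _ (dif_pos h₂))
  have e₃ := neg_one_pow_succAbove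
    ((G.succAbove_vert_bar_collapseHalf x z hx hzx).trans (if_neg hdb))
    ((G.succAbove_vert_bar_collapseHalf z x hz hxz).trans (if_neg hdb.symm))
  rw [e₁, e₂, toChain_iso (G.collapseCommIso x z hx hz hzx hxz h₁ h₂ hcb hdb hac),
    collapseCommIso_sign, smul_units_smul, smul_units_smul, smul_units_smul, ← neg_units_smul]
  congr 3
  rw [mul_mul_mul_comm, e₃, mul_mul_mul_comm, mul_one, neg_mul, mul_comm (G.dir (G.bar x))]

/-- The collapses of two edges anticommute. -/
theorem doubleCollapse_comm (G : OGraph P (k + 2)) (x z : G.H) :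
    G.doubleCollapse x z = -G.doubleCollapse z x := by
  have hbar : (z ≠ x ∧ z ≠ G.bar x) ↔ (x ≠ z ∧ x ≠ G.bar z) := by
    have : z = G.bar x ↔ x = G.bar z :=
      ⟨fun e => by rw [e, G.bar_bar], fun e => by rw [e, G.bar_bar]⟩
    rw [Ne, Ne, Ne, Ne, this, eq_comm]
  by_cases hzx : z ≠ x ∧ z ≠ G.bar x
  swap
  · rw [doubleCollapse, doubleCollapse, dif_neg fun h => hzx h.2,
      dif_neg fun h => hzx (hbar.2 h.2), neg_zero]
  have hxz := hbar.1 hzx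
  have hzx' : G.bar z ≠ x ∧ G.bar z ≠ G.bar x :=
    ⟨fun e => hxz.2 e.symm, fun e => hzx.1 (by rw [← G.bar_bar z, e, G.bar_bar])⟩
  have hxz' : x ≠ G.bar z ∧ x ≠ G.bar (G.bar z) := ⟨hxz.2, by rw [G.bar_bar]; exact hxz.1⟩
  -- A loop stays a loop after any other collapse, so both sides vanish.
  by_cases hx : G.vert x = G.vert (G.bar x)
  · rw [G.doubleCollapse_eq_zero z x (by rw [hx]), doubleCollapse, dif_neg fun h => h.1 hx,
      neg_zero]
  by_cases hz : G.vert z = G.vert (G.bar z)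
  · rw [G.doubleCollapse_eq_zero x z (by rw [hz]), doubleCollapse, dif_neg fun h => h.1 hz,
      neg_zero]
  -- Of two parallel edges, the collapse of one makes the other a loop, so both sides vanish.
  by_cases hpar : (G.vert x = G.vert z ∧ G.vert (G.bar x) = G.vert (G.bar z)) ∨
      (G.vert x = G.vert (G.bar z) ∧ G.vert (G.bar x) = G.vert z)
  · rw [G.doubleCollapse_eq_zero x z (by grind), G.doubleCollapse_eq_zero z x (by grind), neg_zero]
  -- At most one endpoint is now shared. Exchanging the edges or reversing `z` brings it to the one
  -- position that `doubleCollapse_comm_of_ne` allows.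
  by_cases hcb : G.vert z = G.vert (G.bar x)
  · rw [G.doubleCollapse_comm_of_ne z x hxz hz hx (by grind) (by grind) (by grind), neg_neg]
  by_cases hdb : G.vert (G.bar z) = G.vert (G.bar x)
  · rw [← doubleCollapse_bar_right, ← doubleCollapse_bar_left G z x,
      G.doubleCollapse_comm_of_ne (G.bar z) x hxz' (by rw [G.bar_bar]; grind) hx
        (by rw [G.bar_bar]; grind) (by rw [G.bar_bar]; grind) (by grind), neg_neg]
  by_cases hac : G.vert x = G.vert z
  · rw [← doubleCollapse_bar_right, ← doubleCollapse_bar_left G z x]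
    exact G.doubleCollapse_comm_of_ne x (G.bar z) hzx' hx (by rw [G.bar_bar]; grind)
      (by grind) (by rw [G.bar_bar]; grind) (by grind)
  exact G.doubleCollapse_comm_of_ne x z hzx hx hz hcb hdb hac

end OGraph
end

/-! ### Regluing at two pairs of half-edges in either order -/

noncomputable section

variable {P : CyclicOperad.{u}} {k : ℕ}

section pairings

variable {H : Type} [DecidableEq H] {bar : H → H} {dir : H → ℤˣ} {x y z w : H}

/-- Both results pair `x` with `y` and `z` with `w`, and then match the leftover ends of the cut
edges. If the pairs share an edge, say `z = bar x`, the leftover ends are `bar y` and `bar w`, which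
are joined in either order. -/
theorem reglueBar_reglueBar_comm (hb : ∀ h, bar (bar h) = h) (hne : ∀ h, bar h ≠ h)
    (hxy : y ≠ x ∧ y ≠ bar x) (hzw : w ≠ z ∧ w ≠ OGraph.reglueBar bar x y z)
    (hz : z ≠ x ∧ z ≠ y) (hw : w ≠ x ∧ w ≠ y) :
    OGraph.reglueBar (OGraph.reglueBar bar x y) z w =
      OGraph.reglueBar (OGraph.reglueBar bar z w) x y := by
  funext h
  unfold OGraph.reglueBar at *
  grind (splits := 40)

theorem reglue_condition_symm (hb : ∀ h, bar (bar h) = h)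
    (hxy : y ≠ x ∧ y ≠ bar x) (hzw : w ≠ z ∧ w ≠ OGraph.reglueBar bar x y z)
    (hz : z ≠ x ∧ z ≠ y) (hw : w ≠ x ∧ w ≠ y) :
    (w ≠ z ∧ w ≠ bar z) ∧ (y ≠ x ∧ y ≠ OGraph.reglueBar bar z w x) ∧
      (x ≠ z ∧ x ≠ w) ∧ (y ≠ z ∧ y ≠ w) := by
  unfold OGraph.reglueBar at *
  grind (splits := 40)

theorem val_reglueDir (h : H) : (OGraph.reglueDir bar dir x y h : ℤ) =
    if h = x then 1 else if h = y then -1 else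
      if h = bar y then 1 else if h = bar x then -1 else (dir h : ℤ) := by
  unfold OGraph.reglueDir
  split_ifs <;> rfl

/-- The product of the signs of two successive regluings, for the rule that the first half-edge and
the partner of the second one are initial. -/
def reglueSign (bar : H → H) (dir : H → ℤˣ) (x y z w : H) : ℤˣ :=
  dir x * dir (bar y) *
    (OGraph.reglueDir bar dir x y z * OGraph.reglueDir bar dir x y (OGraph.reglueBar bar x y w))

/-- The first regluing makes `x` and `bar y` initial, the second asks this of `z` and of the partner
of `w`. These demands conflict only if `z = bar x` or `w = bar y`, and not both. In that case the
leftover edge, which contains `bar y` or `bar x` respectively, is directed oppositely in the two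
orders, and the product of signs changes as well. So the oriented graphs with signs agree in every
case. -/
theorem reglueDir_reglueDir_comm (hb : ∀ h, bar (bar h) = h) (hne : ∀ h, bar h ≠ h)
    (hd : ∀ h, dir (bar h) = -dir h)
    (hxy : y ≠ x ∧ y ≠ bar x) (hzw : w ≠ z ∧ w ≠ OGraph.reglueBar bar x y z)
    (hz : z ≠ x ∧ z ≠ y) (hw : w ≠ x ∧ w ≠ y) :
    (OGraph.reglueDir (OGraph.reglueBar bar x y) (OGraph.reglueDir bar dir x y) z w =
        OGraph.reglueDir (OGraph.reglueBar bar z w) (OGraph.reglueDir bar dir z w) x y ∧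
      reglueSign bar dir x y z w = reglueSign bar dir z w x y) ∨
    ((∃ p, ∀ h, OGraph.reglueDir (OGraph.reglueBar bar z w) (OGraph.reglueDir bar dir z w) x y h =
        if h = p ∨ h = OGraph.reglueBar (OGraph.reglueBar bar x y) z w p then
          -OGraph.reglueDir (OGraph.reglueBar bar x y) (OGraph.reglueDir bar dir x y) z w h
        else OGraph.reglueDir (OGraph.reglueBar bar x y) (OGraph.reglueDir bar dir x y) z w h) ∧
      reglueSign bar dir x y z w = -reglueSign bar dir z w x y) := by
  have hd' : ∀ h, (dir (bar h) : ℤ) = -dir h := fun h => by rw [hd]; rfl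
  clear hd
  by_cases c1 : z = bar x
  · right
    refine ⟨⟨bar y, fun h => ?_⟩, ?_⟩
    · rw [Units.ext_iff, apply_ite Units.val, Units.val_neg]
      simp only [val_reglueDir, OGraph.reglueBar] at *
      grind (splits := 40)
    · rw [Units.ext_iff]
      simp only [reglueSign, val_reglueDir, OGraph.reglueBar, Units.val_neg, Units.val_mul] at *
      grind (splits := 40)
  by_cases c2 : w = bar y
  · right
    refine ⟨⟨bar x, fun h => ?_⟩, ?_⟩
    · rw [Units.ext_iff, apply_ite Units.val, Units.val_neg]
      simp only [val_reglueDir, OGraph.reglueBar] at *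
      grind (splits := 40)
    · rw [Units.ext_iff]
      simp only [reglueSign, val_reglueDir, OGraph.reglueBar, Units.val_neg, Units.val_mul] at *
      grind (splits := 40)
  left
  refine ⟨funext fun h => ?_, ?_⟩
  · rw [Units.ext_iff]
    simp only [val_reglueDir, OGraph.reglueBar] at *
    grind (splits := 40)
  · rw [Units.ext_iff]
    simp only [reglueSign, val_reglueDir, OGraph.reglueBar, Units.val_mul] at *
    grind (splits := 40)

end pairings
end

/-! ### Reglued graphs under collapse -/

noncomputable section

variable {P : CyclicOperad.{u}} {k : ℕ}

namespace OGraph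

open CyclicOperad.Spider (Agree mateLegs mate)

/-- The identity, between two `𝒪`-graphs that differ only in the directions of the edges. -/
def redirectIso {G G' : OGraph P k} (g : G.H ≃ G'.H) (hv : ∀ h, G'.vert (g h) = G.vert h)
    (hb : ∀ h, G'.bar (g h) = g (G.bar h))
    (hc : ∀ v, Agree (fun h : {h : G.H // G.vert h = v} => g h) (G.color v)
      (Subtype.val : {h // G'.vert h = v} → G'.H) (G'.color v)) : Iso G G' :=
  Iso.ofAgree 1 g hv hb g id Function.injective_id (fun _ => rfl) hc

/-- The product runs effectively over initial halves, and the reversed edge `{p, bar p}` has exactly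
one of them. -/
theorem prod_dir_eq_neg_one {G G' : OGraph P k} (f : Iso G G') (p : G.H)
    (h : ∀ h, G'.dir (f.onHalf h) = if h = p ∨ h = G.bar p then -G.dir h else G.dir h) :
    (∏ h : G.H, if G.dir h = 1 then G'.dir (f.onHalf h) else 1) = -1 := by
  rw [prod_split _ p (G.bar p) (G.bar_ne p), f.dir_pair, f.bar_eq, h, if_pos (Or.inr rfl),
    Finset.prod_eq_one, mul_one, mul_neg, Int.units_mul_self]
  rintro ⟨i, hi⟩ -
  rw [h, if_neg (show ¬(i = p ∨ i = G.bar p) from not_or.2 hi)]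
  split_ifs with h1
  · exact h1
  · rfl

/-- The identity on half-edges is an isomorphism of the two reglued graphs; its sign is exactly the
discrepancy between the two values of `reglueSign`. -/
theorem reglue_reglue_doubleCollapse (G : OGraph P (k + 2)) (x y z w : G.H)
    (hxy : y ≠ x ∧ y ≠ G.bar x) (hzw : w ≠ z ∧ w ≠ reglueBar G.bar x y z)
    (hz : z ≠ x ∧ z ≠ y) (hw : w ≠ x ∧ w ≠ y) (hzw' : w ≠ z ∧ w ≠ G.bar z)
    (hxy' : y ≠ x ∧ y ≠ reglueBar G.bar z w x) :
    ((reglueSign G.bar G.dir x y z w : ℤ) : ℝ) •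
        ((G.reglue x y hxy).reglue z w hzw).doubleCollapse x z =
      ((reglueSign G.bar G.dir z w x y : ℤ) : ℝ) •
        ((G.reglue z w hzw').reglue x y hxy').doubleCollapse x z := by
  let f : Iso ((G.reglue x y hxy).reglue z w hzw) ((G.reglue z w hzw').reglue x y hxy') :=
    redirectIso (Equiv.refl G.H) (fun _ => rfl) (fun h => congrFun
      (reglueBar_reglueBar_comm G.bar_bar G.bar_ne hxy hzw hz hw).symm h) fun _ => Agree.refl _ _
  have e := doubleCollapse_iso f x z
  have hs : f.sign = ∏ h : ((G.reglue x y hxy).reglue z w hzw).H,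
      if ((G.reglue x y hxy).reglue z w hzw).dir h = 1 then
        ((G.reglue z w hzw').reglue x y hxy').dir (f.onHalf h) else 1 := by
    refine (congrArg (· * _) ?_).trans (one_mul _)
    exact Equiv.Perm.sign_one
  rw [e, smul_units_smul]
  rcases reglueDir_reglueDir_comm G.bar_bar G.bar_ne G.dir_bar hxy hzw hz hw with
    ⟨h1, h2⟩ | ⟨⟨p, h1⟩, h2⟩
  · rw [hs, prod_dir_eq_one f fun h => (congrFun h1 h).symm, h2, mul_one]
    rfl
  · rw [hs, prod_dir_eq_neg_one f p h1, h2, mul_neg, mul_one, neg_neg]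
    rfl

theorem reglueBar_of_ne (G : OGraph P k) (x z w : G.H) (hz : z ≠ x ∧ z ≠ G.bar x)
    (hw : w ≠ x ∧ w ≠ G.bar x) : reglueBar G.bar z w x = G.bar x := by
  have := G.bar_bar
  unfold reglueBar
  grind

theorem reglueBar_map {H H' : Type} [DecidableEq H] [DecidableEq H'] {bar : H → H}
    {bar' : H' → H'} (ι : H → H') (hι : Function.Injective ι) (hb : ∀ h, bar' (ι h) = ι (bar h))
    (x y h : H) : reglueBar bar' (ι x) (ι y) (ι h) = ι (reglueBar bar x y h) := by
  simp only [reglueBar, hb, hι.eq_iff]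
  split_ifs <;> rfl

theorem reglueDir_map {H H' : Type} [DecidableEq H] [DecidableEq H'] {bar : H → H}
    {bar' : H' → H'} {dir : H → ℤˣ} {dir' : H' → ℤˣ} (ι : H → H') (hι : Function.Injective ι)
    (hb : ∀ h, bar' (ι h) = ι (bar h)) (hd : ∀ h, dir' (ι h) = dir h) (x y h : H) :
    reglueDir bar' dir' (ι x) (ι y) (ι h) = reglueDir bar dir x y h := by
  simp only [reglueDir, hb, hι.eq_iff, hd]

section collapseReglue

variable (G : OGraph P (k + 1)) (x z w : G.H) (hx : G.vert x ≠ G.vert (G.bar x))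
  (hzw : w ≠ z ∧ w ≠ G.bar z) (hz : z ≠ x ∧ z ≠ G.bar x) (hw : w ≠ x ∧ w ≠ G.bar x)

/-- Collapsing an edge commutes with cutting and regluing two other edges. -/
def collapseReglueIso
    (hx' : (G.reglue z w hzw).vert x ≠ (G.reglue z w hzw).vert ((G.reglue z w hzw).bar x))
    (hzw' : G.collapseHalf x hx w hw ≠ G.collapseHalf x hx z hz ∧
      G.collapseHalf x hx w hw ≠ (G.collapse x hx).bar (G.collapseHalf x hx z hz)) :
    Iso ((G.collapse x hx).reglue (G.collapseHalf x hx z hz) (G.collapseHalf x hx w hw) hzw')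
      ((G.reglue z w hzw).collapse x hx') :=
  have hb : (G.reglue z w hzw).bar x = G.bar x := G.reglueBar_of_ne x z w hz hw
  have hb' : (G.reglue z w hzw).vert ((G.reglue z w hzw).bar x) = G.vert (G.bar x) :=
    congrArg G.vert hb
  Iso.ofAgree 1 (Equiv.subtypeEquivRight fun h => by rw [hb]; exact Iff.rfl)
    (fun h => by
      refine (mergeVert_eq_iff _ _ hx' _ _).2 ?_
      rw [hb']
      exact (succAbove_mergeVert _ _ hx (G.vert h.1)).symm)
    (fun h => Subtype.ext (reglueBar_map (bar := (G.collapse x hx).bar) (bar' := G.bar)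
      Subtype.val Subtype.val_injective (fun _ => rfl) (G.collapseHalf x hx z hz)
      (G.collapseHalf x hx w hw) h))
    Subtype.val Subtype.val Subtype.val_injective (fun _ => rfl)
    (fun t => by
      by_cases ht : (G.vert (G.bar x)).succAbove t = G.vert x
      · have A := G.collapse_agree_merged x hx t _ _ ht rfl rfl
        have B := (G.reglue z w hzw).collapse_agree_merged x hx' t _ _ (by rw [hb']; exact ht) rfl
          hb'
        refine A.trans (Agree.trans ?_ B.symm)
        -- The partner of `x` after regluing equals `bar x` only by `hb`, so the statement is
        -- generalized to a leg `b` equal to it.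
        have e : ∀ b : {h // G.vert h = G.vert (G.bar x)}, b = ⟨G.bar x, rfl⟩ →
            Agree (mateLegs Subtype.val Subtype.val (⟨x, rfl⟩ : {h // G.vert h = G.vert x})
                (⟨G.bar x, rfl⟩ : {h // G.vert h = G.vert (G.bar x)}))
              (mate ⟨x, rfl⟩ ⟨G.bar x, rfl⟩ (G.color (G.vert x)) (G.color (G.vert (G.bar x))))
              (mateLegs Subtype.val Subtype.val (⟨x, rfl⟩ : {h // G.vert h = G.vert x}) b)
              (mate (⟨x, rfl⟩ : {h // G.vert h = G.vert x}) b (G.color (G.vert x)) (G.color (G.vert (G.bar x)))) := by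
          rintro _ rfl
          exact Agree.refl _ _
        exact e _ (Subtype.ext hb)
      · exact (G.collapse_agree_other x hx t _ rfl ht).trans
          ((G.reglue z w hzw).collapse_agree_other x hx' t _ (by rw [hb']) ht).symm)

theorem collapseReglueIso_sign (hx' hzw') :
    (G.collapseReglueIso x z w hx hzw hz hw hx' hzw').sign = 1 := by
  have h := prod_dir_eq_one (G.collapseReglueIso x z w hx hzw hz hw hx' hzw') fun h =>
    reglueDir_map (bar := (G.collapse x hx).bar) (bar' := G.bar) (dir := (G.collapse x hx).dir)
      (dir' := G.dir) Subtype.val Subtype.val_injective (fun _ => rfl) (fun _ => rfl)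
      (G.collapseHalf x hx z hz) (G.collapseHalf x hx w hw) h
  rw [Iso.sign, h, mul_one]
  exact Equiv.Perm.sign_one

end collapseReglue

end OGraph
end

/-! ### The terms of the composite boundaries and their cancellation -/

noncomputable section

variable {P : CyclicOperad.{u}} {k : ℕ}

namespace OGraph

theorem sum_subtype_eq_sum_dite {M H : Type*} [AddCommMonoid M] [Fintype H] (p : H → Prop)
    [DecidablePred p] [Fintype {h // p h}] (F : {h // p h} → M) :
    ∑ h, F h = ∑ h, if hp : p h then F ⟨h, hp⟩ else 0 := by
  rw [← Finset.sum_filter_of_ne (p := p) fun h _ h' => by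
    by_contra h0
    exact h' (dif_neg h0)]
  rw [Finset.sum_subtype (Finset.univ.filter p) (p := p) (by simp)]
  refine Finset.sum_congr rfl fun h _ => Eq.symm ?_
  exact dif_pos h.2

theorem chain_hom_ext {M : Type*} [AddCommGroup M] [Module ℝ M] {f g : ChainGroup P k →ₗ[ℝ] M}
    (h : ∀ G : OGraph P k, f G.toChain = g G.toChain) : f = g :=
  Submodule.linearMap_qext _ (Finsupp.lhom_ext' fun G => LinearMap.ext_ring (h G))

theorem eq_zero_of_eq_neg {M : Type*} [AddCommGroup M] [Module ℝ M] {a : M} (h : a = -a) :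
    a = 0 := by
  have h2 : (2 : ℝ) • a = 0 := by
    rw [two_smul]
    nth_rewrite 1 [h]
    exact neg_add_cancel a
  exact (smul_eq_zero.1 h2).resolve_left two_ne_zero

section terms

variable (G : OGraph P (k + 2)) (x y z w : G.H)

/-- The effect of cutting and regluing at `z`, `w` and collapsing after the collapse of the edge of
`x`. -/
def collapseReglue : ChainGroup P k :=
  if h : (w ≠ z ∧ w ≠ G.bar z) ∧ (z ≠ x ∧ z ≠ G.bar x) ∧ (w ≠ x ∧ w ≠ G.bar x) then
    (((G.dir z * G.dir (G.bar w) : ℤˣ) : ℤ) : ℝ) • (G.reglue z w h.1).doubleCollapse x z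
  else 0

/-- Regluing other edges changes neither the partner of `x` nor the direction of its edge, so the
sign of the first collapse is unaffected. The regluing can therefore be moved in front of both
collapses. -/
theorem hTerm_collapse (hx : G.vert x ≠ G.vert (G.bar x)) (hz : z ≠ x ∧ z ≠ G.bar x)
    (hw : w ≠ x ∧ w ≠ G.bar x) :
    ((((-1) ^ (G.vert (G.bar x) : ℕ) * G.dir (G.bar x) : ℤˣ) : ℤ) : ℝ) •
      (G.collapse x hx).hTerm (G.collapseHalf x hx z hz) (G.collapseHalf x hx w hw) =
    G.collapseReglue x z w := by
  by_cases hzw : w ≠ z ∧ w ≠ G.bar z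
  · have hzw' : G.collapseHalf x hx w hw ≠ G.collapseHalf x hx z hz ∧
        G.collapseHalf x hx w hw ≠ (G.collapse x hx).bar (G.collapseHalf x hx z hz) :=
      ⟨fun e => hzw.1 (congrArg Subtype.val e), fun e => hzw.2 (congrArg Subtype.val e)⟩
    have hb : (G.reglue z w hzw).bar x = G.bar x := G.reglueBar_of_ne x z w hz hw
    have hx' : (G.reglue z w hzw).vert x ≠ (G.reglue z w hzw).vert ((G.reglue z w hzw).bar x) := by
      rw [hb]; exact hx
    have hz' : z ≠ x ∧ z ≠ (G.reglue z w hzw).bar x := by rw [hb]; exact hz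
    have hd : (G.reglue z w hzw).dir ((G.reglue z w hzw).bar x) = G.dir (G.bar x) := by
      have hbb := G.bar_bar
      rw [hb]
      change reglueDir G.bar G.dir z w (G.bar x) = _
      unfold reglueDir
      grind
    have e₁ : (G.collapse x hx).hTerm (G.collapseHalf x hx z hz) (G.collapseHalf x hx w hw) =
        (((G.dir z * G.dir (G.bar w) : ℤˣ) : ℤ) : ℝ) •
          ((G.collapse x hx).reglue _ _ hzw').collapseTerm (G.collapseHalf x hx z hz) :=
      dif_pos hzw'
    have e₂ : ((G.collapse x hx).reglue _ _ hzw').collapseTerm (G.collapseHalf x hx z hz) =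
        ((G.reglue z w hzw).collapse x hx').collapseTerm
          ((G.reglue z w hzw).collapseHalf x hx' z hz') := by
      have := collapseTerm_iso (G.collapseReglueIso x z w hx hzw hz hw hx' hzw')
        (G.collapseHalf x hx z hz)
      rw [collapseReglueIso_sign] at this
      refine this.trans ?_
      rw [Units.val_one, Int.cast_one, one_smul]
      rfl
    have e₃ : (G.reglue z w hzw).doubleCollapse x z =
        ((((-1) ^ (G.vert (G.bar x) : ℕ) * G.dir (G.bar x) : ℤˣ) : ℤ) : ℝ) •
        ((G.reglue z w hzw).collapse x hx').collapseTerm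
          ((G.reglue z w hzw).collapseHalf x hx' z hz') := by
      have hv : (G.reglue z w hzw).vert ((G.reglue z w hzw).bar x) = G.vert (G.bar x) :=
        congrArg G.vert hb
      rw [← hd, ← hv]
      exact dif_pos ⟨hx', hz'⟩
    rw [e₁, e₂, collapseReglue, dif_pos ⟨hzw, hz, hw⟩, e₃, smul_comm]
  · have hzw' : ¬(G.collapseHalf x hx w hw ≠ G.collapseHalf x hx z hz ∧
        G.collapseHalf x hx w hw ≠ (G.collapse x hx).bar (G.collapseHalf x hx z hz)) := fun h =>
      hzw ⟨fun e => h.1 (Subtype.ext e), fun e => h.2 (Subtype.ext e)⟩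
    rw [hTerm, dif_neg hzw', collapseReglue, dif_neg fun h => hzw h.1, smul_zero]

theorem edgeBoundaryAt_collapseTerm :
    edgeBoundaryAt P k (G.collapseTerm x) = (1 / 2 : ℝ) • ∑ z : G.H, G.doubleCollapse x z := by
  by_cases hx : G.vert x ≠ G.vert (G.bar x)
  · rw [collapseTerm, dif_pos hx, map_smul, edgeBoundaryAt_toChain, smul_comm]
    congr 1
    refine (congrArg _ (sum_subtype_eq_sum_dite (fun h => h ≠ x ∧ h ≠ G.bar x) fun h =>
      (G.collapse x hx).collapseTerm h)).trans ?_
    rw [Finset.smul_sum]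
    refine Finset.sum_congr rfl fun z _ => ?_
    by_cases hz : z ≠ x ∧ z ≠ G.bar x
    · rw [dif_pos hz, doubleCollapse, dif_pos ⟨hx, hz⟩]
      rfl
    · rw [dif_neg hz, doubleCollapse, dif_neg fun h => hz h.2, smul_zero]
  · rw [collapseTerm, dif_neg hx, map_zero, Finset.sum_eq_zero, smul_zero]
    intro z _
    rw [doubleCollapse, dif_neg fun h => hx h.1]

theorem hBoundaryAt_collapseTerm :
    hBoundaryAt P k (G.collapseTerm x) =
      (1 / 2 : ℝ) • ∑ p : G.H × G.H, G.collapseReglue x p.1 p.2 := by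
  by_cases hx : G.vert x ≠ G.vert (G.bar x)
  · rw [collapseTerm, dif_pos hx, map_smul, hBoundaryAt_toChain, smul_comm]
    congr 1
    rw [Fintype.sum_prod_type, Fintype.sum_prod_type]
    refine (congrArg _ (sum_subtype_eq_sum_dite (fun h => h ≠ x ∧ h ≠ G.bar x) fun h =>
      ∑ h', (G.collapse x hx).hTerm h h')).trans ?_
    rw [Finset.smul_sum]
    refine Finset.sum_congr rfl fun z _ => ?_
    by_cases hz : z ≠ x ∧ z ≠ G.bar x
    · rw [dif_pos hz]
      refine (congrArg _ (sum_subtype_eq_sum_dite (fun h => h ≠ x ∧ h ≠ G.bar x) fun h =>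
        (G.collapse x hx).hTerm (G.collapseHalf x hx z hz) h)).trans ?_
      rw [Finset.smul_sum]
      refine Finset.sum_congr rfl fun w _ => ?_
      by_cases hw : w ≠ x ∧ w ≠ G.bar x
      · rw [dif_pos hw]
        exact G.hTerm_collapse x z w hx hz hw
      · rw [dif_neg hw, collapseReglue, dif_neg fun h => hw h.2.2, smul_zero]
    · rw [dif_neg hz, smul_zero, Finset.sum_eq_zero]
      intro w _
      rw [collapseReglue, dif_neg fun h => hz h.2.1]
  · rw [collapseTerm, dif_neg hx, map_zero, Finset.sum_eq_zero, smul_zero]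
    intro p _
    rw [collapseReglue]
    split_ifs with h
    · have hb : (G.reglue p.1 p.2 h.1).bar x = G.bar x := G.reglueBar_of_ne x _ _ h.2.1 h.2.2
      refine (congrArg _ (dif_neg fun h' => hx ?_)).trans (smul_zero _)
      have h1 := h'.1
      rw [hb] at h1
      exact h1
    · rfl

/-- The contribution of the pairs `x`, `y` and `z`, `w` to the square of the H-boundary. -/
def hhTerm : ChainGroup P k :=
  if h : (y ≠ x ∧ y ≠ G.bar x) ∧ (w ≠ z ∧ w ≠ reglueBar G.bar x y z) ∧ (z ≠ x ∧ z ≠ y) ∧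
      (w ≠ x ∧ w ≠ y) then
    ((reglueSign G.bar G.dir x y z w : ℤ) : ℝ) •
      ((G.reglue x y h.1).reglue z w h.2.1).doubleCollapse x z
  else 0

/-- The two regluings can be interchanged without a sign, so the only sign comes from collapsing `x
∪ y` and `z ∪ w` in the other order. -/
theorem hhTerm_swap : G.hhTerm z w x y = -G.hhTerm x y z w := by
  by_cases h : (y ≠ x ∧ y ≠ G.bar x) ∧ (w ≠ z ∧ w ≠ reglueBar G.bar x y z) ∧ (z ≠ x ∧ z ≠ y) ∧
      (w ≠ x ∧ w ≠ y)
  · have h' := reglue_condition_symm G.bar_bar h.1 h.2.1 h.2.2.1 h.2.2.2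
    have e := ((G.reglue z w h'.1).reglue x y h'.2.1).doubleCollapse_comm z x
    rw [hhTerm, hhTerm, dif_pos h, dif_pos h',
      G.reglue_reglue_doubleCollapse x y z w h.1 h.2.1 h.2.2.1 h.2.2.2 h'.1 h'.2.1, ← smul_neg]
    exact congrArg _ e
  · rw [hhTerm, hhTerm, dif_neg h, dif_neg, neg_zero]
    exact fun h' => h (reglue_condition_symm G.bar_bar h'.1 h'.2.1 h'.2.2.1 h'.2.2.2)

theorem hBoundaryAt_hTerm :
    hBoundaryAt P k (G.hTerm x y) = (1 / 2 : ℝ) • ∑ p : G.H × G.H, G.hhTerm x y p.1 p.2 := by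
  by_cases hxy : y ≠ x ∧ y ≠ G.bar x
  · rw [hTerm, dif_pos hxy, map_smul, (G.reglue x y hxy).hBoundaryAt_collapseTerm x, smul_comm, Finset.smul_sum]
    refine congrArg _ ?_
    refine Finset.sum_congr rfl fun p _ => ?_
    obtain ⟨z, w⟩ := p
    -- The collapsed edge is now `{x, y}`; this is why `hhTerm` excludes `x` and `y`, but not `bar
    -- x` and `bar y`, from the second pair.
    have hb : (G.reglue x y hxy).bar x = y := if_pos rfl
    by_cases h : (w ≠ z ∧ w ≠ reglueBar G.bar x y z) ∧ (z ≠ x ∧ z ≠ y) ∧ (w ≠ x ∧ w ≠ y)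
    · have h' : (w ≠ z ∧ w ≠ (G.reglue x y hxy).bar z) ∧ (z ≠ x ∧ z ≠ (G.reglue x y hxy).bar x) ∧
          (w ≠ x ∧ w ≠ (G.reglue x y hxy).bar x) := by rw [hb]; exact h
      rw [hhTerm, dif_pos ⟨hxy, h⟩]
      refine (congrArg _ (dif_pos h')).trans ?_
      exact smul_units_smul _ _ _
    · have h' : ¬((w ≠ z ∧ w ≠ (G.reglue x y hxy).bar z) ∧
          (z ≠ x ∧ z ≠ (G.reglue x y hxy).bar x) ∧
          (w ≠ x ∧ w ≠ (G.reglue x y hxy).bar x)) := by rw [hb]; exact h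
      rw [hhTerm, dif_neg fun h0 => h h0.2]
      refine (congrArg _ (dif_neg h')).trans (smul_zero _)
  · rw [hTerm, dif_neg hxy, map_zero, Finset.sum_eq_zero, smul_zero]
    intro p _
    rw [hhTerm, dif_neg fun h => hxy h.1]

/-- The contribution of the pair `x`, `y` and the half-edge `z` to `∂_E ∂_H`. -/
def heTerm : ChainGroup P k :=
  if h : y ≠ x ∧ y ≠ G.bar x then
    (((G.dir x * G.dir (G.bar y) : ℤˣ) : ℤ) : ℝ) • (G.reglue x y h).doubleCollapse x z
  else 0

theorem edgeBoundaryAt_hTerm :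
    edgeBoundaryAt P k (G.hTerm x y) = (1 / 2 : ℝ) • ∑ z : G.H, G.heTerm x y z := by
  by_cases hxy : y ≠ x ∧ y ≠ G.bar x
  · rw [hTerm, dif_pos hxy, map_smul, (G.reglue x y hxy).edgeBoundaryAt_collapseTerm x, smul_comm, Finset.smul_sum]
    refine congrArg _ ?_
    refine Finset.sum_congr rfl fun z _ => ?_
    have e : G.heTerm x y z = (((G.dir x * G.dir (G.bar y) : ℤˣ) : ℤ) : ℝ) •
        (G.reglue x y hxy).doubleCollapse x z := dif_pos hxy
    exact e.symm
  · rw [hTerm, dif_neg hxy, map_zero, Finset.sum_eq_zero, smul_zero]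
    intro p _
    rw [heTerm, dif_neg hxy]

/-- After the regluing `bar x` and `bar y` are the two halves of one edge. -/
theorem heTerm_bar_left : G.heTerm x y (G.bar x) = G.heTerm x y (G.bar y) := by
  by_cases hxy : y ≠ x ∧ y ≠ G.bar x
  · have hb : (G.reglue x y hxy).bar (G.bar x) = G.bar y := by
      have := G.bar_bar
      have := G.bar_ne
      change reglueBar G.bar x y (G.bar x) = _
      unfold reglueBar
      grind
    have e := (G.reglue x y hxy).doubleCollapse_bar_right x (G.bar x)
    rw [hb] at e
    rw [heTerm, heTerm, dif_pos hxy, dif_pos hxy]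
    exact congrArg _ e.symm
  · rw [heTerm, heTerm, dif_neg hxy, dif_neg hxy]

/-- The regluing rule is invariant under `(x, y) ↦ (bar y, bar x)`: both pairs create the same two
edges, direct them in the same way and carry the same sign. What differs is which of the two new
edges is collapsed first. -/
theorem heTerm_bar_right :
    G.heTerm (G.bar y) (G.bar x) x = -G.heTerm x y (G.bar y) := by
  have hbb := G.bar_bar
  have hbn := G.bar_ne
  by_cases hxy : y ≠ x ∧ y ≠ G.bar x
  · have hxy' : G.bar x ≠ G.bar y ∧ G.bar x ≠ G.bar (G.bar y) := by grind
    have hd : ∀ h, reglueDir G.bar G.dir (G.bar y) (G.bar x) h = reglueDir G.bar G.dir x y h := by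
      intro h
      unfold reglueDir
      grind
    have hb : ∀ h, reglueBar G.bar (G.bar y) (G.bar x) h = reglueBar G.bar x y h := by
      intro h
      unfold reglueBar
      grind
    let f : Iso (G.reglue (G.bar y) (G.bar x) hxy') (G.reglue x y hxy) :=
      redirectIso (Equiv.refl G.H) (fun _ => rfl) (fun h => (hb h).symm)
        fun _ => CyclicOperad.Spider.Agree.refl _ _
    have hs : f.sign = 1 := by
      rw [Iso.sign, prod_dir_eq_one f fun h => (hd h).symm, mul_one]
      exact Equiv.Perm.sign_one
    have e := doubleCollapse_iso f (G.bar y) x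
    rw [hs, Units.val_one, Int.cast_one, one_smul] at e
    rw [heTerm, heTerm, dif_pos hxy, dif_pos hxy', e, doubleCollapse_comm, G.bar_bar,
      mul_comm (G.dir x), smul_neg]
    rfl
  · have hxy' : ¬(G.bar x ≠ G.bar y ∧ G.bar x ≠ G.bar (G.bar y)) := by grind
    rw [heTerm, heTerm, dif_neg hxy, dif_neg hxy', neg_zero]

/-- For `z` off the cut edges, the two terms are double collapses of the same reglued graph in
opposite orders and cancel. What survives is the collapse of both new edges, seen from either half
of the second one. -/
theorem heTerm_add_collapseReglue : G.heTerm x y z + G.collapseReglue z x y =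
    (if z = G.bar x then G.heTerm x y (G.bar y) else 0) +
      if z = G.bar y then G.heTerm x y (G.bar y) else 0 := by
  have hbb := G.bar_bar
  have hbn := G.bar_ne
  by_cases hxy : y ≠ x ∧ y ≠ G.bar x
  swap
  · simp [heTerm, collapseReglue, hxy]
  have hb : (G.reglue x y hxy).bar x = y := if_pos rfl
  by_cases hc : (x ≠ z ∧ x ≠ G.bar z) ∧ (y ≠ z ∧ y ≠ G.bar z)
  · rw [if_neg (by grind), if_neg (by grind), collapseReglue, dif_pos ⟨hxy, hc⟩, heTerm,
      dif_pos hxy, (G.reglue x y hxy).doubleCollapse_comm x z, smul_neg, add_zero]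
    exact neg_add_cancel _
  · rw [collapseReglue, dif_neg fun h => hc h.2, add_zero]
    by_cases h1 : z = G.bar x
    · rw [if_pos h1, if_neg (by grind), add_zero, h1, heTerm_bar_left]
    by_cases h2 : z = G.bar y
    · rw [if_neg h1, if_pos h2, zero_add, h2]
    -- Now `z` is `x` or `y`, a half of the edge that has already been collapsed.
    rw [if_neg h1, if_neg h2, add_zero, heTerm, dif_pos hxy]
    refine (congrArg _ (dif_neg fun h => ?_)).trans (smul_zero _)
    have h3 := h.2
    rw [hb] at h3
    grind

end terms

/-! ### The identities on chains and on the whole complex -/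

theorem hBoundaryAt_comp_hBoundaryAt : hBoundaryAt P k ∘ₗ hBoundaryAt P (k + 1) = 0 := by
  refine chain_hom_ext fun G => ?_
  rw [LinearMap.comp_apply, hBoundaryAt_toChain, map_smul, map_sum, LinearMap.zero_apply]
  simp only [hBoundaryAt_hTerm]
  rw [← Finset.smul_sum]
  have h : ∑ p : G.H × G.H, ∑ q : G.H × G.H, G.hhTerm p.1 p.2 q.1 q.2 = 0 := by
    refine eq_zero_of_eq_neg ?_
    conv_lhs => rw [Finset.sum_comm]
    simp only [← Finset.sum_neg_distrib]
    exact Finset.sum_congr rfl fun p _ => Finset.sum_congr rfl fun q _ => G.hhTerm_swap _ _ _ _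
  rw [h, smul_zero, smul_zero]

/-- The involution `(x, y) ↦ (bar y, bar x)` of the index set changes the sign of the summand. Fixed
points do no harm, as real multiples are available. -/
theorem sum_heTerm_bar (G : OGraph P (k + 2)) :
    ∑ p : G.H × G.H, G.heTerm p.1 p.2 (G.bar p.2) = 0 := by
  refine eq_zero_of_eq_neg ?_
  let b : G.H ≃ G.H := ⟨G.bar, G.bar, G.bar_bar, G.bar_bar⟩
  rw [← Finset.sum_neg_distrib]
  refine Fintype.sum_equiv ((Equiv.prodComm _ _).trans (b.prodCongr b)) _ _ fun p => ?_
  change _ = -G.heTerm (G.bar p.2) (G.bar p.1) (G.bar (G.bar p.1))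
  rw [G.bar_bar, heTerm_bar_right, neg_neg]

theorem hBoundaryAt_edgeBoundaryAt_anticomm :
    hBoundaryAt P k ∘ₗ edgeBoundaryAt P (k + 1) + edgeBoundaryAt P k ∘ₗ hBoundaryAt P (k + 1) =
      0 := by
  refine chain_hom_ext fun G => ?_
  rw [LinearMap.add_apply, LinearMap.comp_apply, LinearMap.comp_apply, hBoundaryAt_toChain,
    edgeBoundaryAt_toChain, map_smul, map_smul, map_sum, map_sum, LinearMap.zero_apply]
  simp only [hBoundaryAt_collapseTerm, edgeBoundaryAt_hTerm]
  rw [← Finset.smul_sum, ← Finset.smul_sum, ← smul_add, ← smul_add, Finset.sum_comm,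
    ← Finset.sum_add_distrib]
  -- For a fixed pair only `z = bar x` and `z = bar y` contribute, equally, because they are the two
  -- halves of the second new edge.
  have h : ∀ p : G.H × G.H, ∑ z, G.collapseReglue z p.1 p.2 + ∑ z, G.heTerm p.1 p.2 z =
      G.heTerm p.1 p.2 (G.bar p.2) + G.heTerm p.1 p.2 (G.bar p.2) := fun p => by
    rw [add_comm, ← Finset.sum_add_distrib]
    simp only [heTerm_add_collapseReglue]
    rw [Finset.sum_add_distrib, Finset.sum_ite_eq', Finset.sum_ite_eq',
      if_pos (Finset.mem_univ _), if_pos (Finset.mem_univ _)]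
  simp only [h]
  rw [Finset.sum_add_distrib, sum_heTerm_bar, add_zero, smul_zero, smul_zero]

end OGraph

theorem lowerDegree_comp_eq (d d' : ∀ k, ChainGroup P (k + 1) →ₗ[ℝ] ChainGroup P k) (k : ℕ)
    (c : ChainGroup P (k + 2)) :
    lowerDegree P d (lowerDegree P d' (DirectSum.lof ℝ ℕ (ChainGroup P) (k + 2) c)) =
      DirectSum.lof ℝ ℕ (ChainGroup P) k (d k (d' (k + 1) c)) := by
  simp [lowerDegree, DirectSum.toModule_lof]

/-- Degree `0` is killed by definition, so fewer than two vertices do not survive two steps down. -/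
theorem lowerDegree_comp_eq_zero (d d' : ∀ k, ChainGroup P (k + 1) →ₗ[ℝ] ChainGroup P k) (k : ℕ)
    (hk : k < 2) (c : ChainGroup P k) :
    lowerDegree P d (lowerDegree P d' (DirectSum.lof ℝ ℕ (ChainGroup P) k c)) = 0 := by
  interval_cases k <;> simp [lowerDegree, DirectSum.toModule_lof]

end

theorem mainTheorem11 (P : CyclicOperad.{u}) :
    hBoundary P ∘ₗ hBoundary P = 0 ∧
      hBoundary P ∘ₗ edgeBoundary P + edgeBoundary P ∘ₗ hBoundary P = 0 := by
  constructor
  · refine DirectSum.linearMap_ext ℝ fun k => LinearMap.ext fun c => ?_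
    simp only [LinearMap.comp_apply, LinearMap.zero_apply, hBoundary]
    rcases k with _ | _ | k
    · exact lowerDegree_comp_eq_zero _ _ 0 (by omega) c
    · exact lowerDegree_comp_eq_zero _ _ 1 (by omega) c
    · rw [lowerDegree_comp_eq, ← LinearMap.comp_apply (OGraph.hBoundaryAt P k), OGraph.hBoundaryAt_comp_hBoundaryAt,
        LinearMap.zero_apply, map_zero]
  · refine DirectSum.linearMap_ext ℝ fun k => LinearMap.ext fun c => ?_
    simp only [LinearMap.comp_apply, LinearMap.zero_apply, LinearMap.add_apply, hBoundary,
      edgeBoundary]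
    rcases k with _ | _ | k
    · rw [lowerDegree_comp_eq_zero _ _ 0 (by omega), lowerDegree_comp_eq_zero _ _ 0 (by omega),
        add_zero]
    · rw [lowerDegree_comp_eq_zero _ _ 1 (by omega), lowerDegree_comp_eq_zero _ _ 1 (by omega),
        add_zero]
    · rw [lowerDegree_comp_eq, lowerDegree_comp_eq, ← map_add,
        ← LinearMap.comp_apply (OGraph.hBoundaryAt P k),
        ← LinearMap.comp_apply (OGraph.edgeBoundaryAt P k), ← LinearMap.add_apply,
        OGraph.hBoundaryAt_edgeBoundaryAt_anticomm, LinearMap.zero_apply, map_zero]
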